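/- For $n\ge 1$, $f\in C[0,1]$ let $B_n f(x)=\sum_{k=0}^n f(k/n)\binom nk x^k(1-x)^{n-k}$ be the Bernstein operator, and let $\bar{\mathbb B}_n$ be the genuine Beta operator on $C[0,1]$, $$\bar{\mathbb B}_n f(x)=\frac{1}{B(nx,n(1-x))}\int_0^1 t^{nx-1}(1-t)^{n(1-x)-1}f(t)\,dt\quad(0<x<1),\qquad \bar{\mathbb B}_nf(0)=f(0),\ \bar{\mathbb B}_nf(1)=f(1).$$ Let $\Pi_n$ be the space of real polynomials of degree at most $n$. The operator $\bar{\mathbb B}_n:\Pi_n\to\Pi_n$ is bijective; put $F_n=\bar{\mathbb B}_n^{-1}\circ B_n: C[0,1]\to\Pi_n$. For $0\le k\le n$ let $\lambda_k^{(n)}=\frac{n!}{(n-k)!\,n^k}$ and let $p_k^{(n)}$ be the unique monic polynomial of degree $k$ with $B_np_k^{(n)}=\lambda_k^{(n)}p_k^{(n)}$, where for $k=1$ one normalises $p_1^{(n)}(x)=x-\frac12$. Let $\mu_k^{(n)}(f)$, $0\le k\le n$, be the unique coefficients with $B_nf=\sum_{k=0}^n\lambda_k^{(n)}\mu_k^{(n)}(f)\,p_k^{(n)}$,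 $f\in C[0,1]$. With the Jacobi polynomials $P_m^{(1,1)}$ put $p_0^*(x)=1$, $p_1^*(x)=x-\frac12$, $\mu_0^*(f)=\frac{f(0)+f(1)}2$, $\mu_1^*(f)=f(1)-f(0)$, and for $k\ge2$ $$p_k^*(x)=\frac{k!\,(k-2)!}{(2k-2)!}\,x(x-1)P_{k-2}^{(1,1)}(2x-1),\qquad \mu_k^*(f)=\frac12\binom{2k}{k}\Big((-1)^kf(0)+f(1)-k\int_0^1 f(x)P_{k-2}^{(1,1)}(2x-1)\,dx\Big).$$ All limits of functions below are in $C[0,1]$ with the uniform norm. (a) The objects above are well defined, and for every $s\ge0$, $k\ge 0$ and every polynomial $p$, $\lim_{n\to\infty}p_s^{(n)}=p_s^*$ and $\lim_{n\to\infty}\mu_k^{(n)}(p)=\mu_k^*(p)$. (b) For every $s\ge0$, $$\lim_{n\to\infty}\bar{\mathbb B}_n^{-1}(p_s^{(n)})=p_s^*,\qquad \lim_{n\to\infty}F_n(p_s^{(n)})=p_s^*,\qquad \mu_s^*(p_s^*)=1.$$ (c) Suppose that the Cooper–Waldron conjecture holds, that is, $\lim_{n\to\infty}\mu_k^{(n)}(f)=\mu_k^*(f)$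 for all $k\ge0$ and all $f\in C[0,1]$. If for a function $f\in C[0,1]$ the limits may be interchanged, $$\lim_{n\to\infty}\sum_{k=0}^n\lambda_k^{(n)}\mu_k^{(n)}(f)\,\bar{\mathbb B}_n^{-1}(p_k^{(n)})=\sum_{k=0}^\infty\lim_{n\to\infty}\lambda_k^{(n)}\mu_k^{(n)}(f)\,\bar{\mathbb B}_n^{-1}(p_k^{(n)}),$$ meaning that all these limits, and the series as the limit of its partial sums, exist in $C[0,1]$ and the two sides agree, then $\sum_{k=0}^\infty\mu_k^*(f)\,p_k^*$ converges in $C[0,1]$ and $$\lim_{n\to\infty}F_nf=\sum_{k=0}^\infty\mu_k^*(f)\,p_k^*.$$ -/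

import Mathlib

open Filter Topology Polynomial

open scoped unitInterval

noncomputable section

/-- A real polynomial as an element of `C[0,1]` (with the topology of uniform convergence). -/
def polyFun (p : ℝ[X]) : C(I, ℝ) := p.toContinuousMapOn I

/-- The Bernstein operator `B_n : C[0,1] → Π_n`,
`B_n f = ∑_{k=0}^n f (k/n) * binom(n,k) x^k (1-x)^(n-k)`; here `bernstein.z k` is the point `k/n`. -/
def bernsteinOp (n : ℕ) (f : C(I, ℝ)) : ℝ[X] :=
  ∑ k : Fin (n + 1), C (f (bernstein.z k)) * bernsteinPolynomial ℝ n k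

/-- The Beta operator on `C[0,1]`: `f 0` at `x = 0`, `f 1` at `x = 1`, and
`B(nx, n(1-x))⁻¹ ∫₀¹ t^(nx-1) (1-t)^(n(1-x)-1) f(t) dt` at `0 < x < 1`. -/
def betaOp (n : ℕ) (f : C(I, ℝ)) (x : I) : ℝ :=
  if x = 0 then f 0
  else if x = 1 then f 1
  else (∫ t : I, (t : ℝ) ^ (n * (x : ℝ) - 1) * (1 - (t : ℝ)) ^ (n * (1 - (x : ℝ)) - 1) * f t) /
    ProbabilityTheory.beta (n * (x : ℝ)) (n * (1 - (x : ℝ)))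

/-- `q` is a preimage of `p` in `Π_n` under the Beta operator. -/
def IsBetaPreimage (n : ℕ) (p q : ℝ[X]) : Prop :=
  q ∈ degreeLE ℝ n ∧ betaOp n (polyFun q) = polyFun p

/-- The inverse of the Beta operator on `Π_n`. -/
def betaInv (n : ℕ) (p : ℝ[X]) : ℝ[X] := Classical.epsilon (IsBetaPreimage n p)

/-- The operator `F_n`: the Bernstein operator followed by the inverse of the Beta operator. -/
def opF (n : ℕ) (f : C(I, ℝ)) : ℝ[X] := betaInv n (bernsteinOp n f)

/-- `λ_k^{(n)} = n! / ((n-k)! n^k)`. -/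
def bernsteinEigenvalue (n k : ℕ) : ℝ := (n.descFactorial k : ℝ) / (n : ℝ) ^ k

/-- `p` is the monic eigenpolynomial of degree `k` of `B_n`. Since the eigenvalue `1` is double,
the one of degree `1` is normalised to be `x - 1/2`. -/
def IsBernsteinEigenpoly (n k : ℕ) (p : ℝ[X]) : Prop :=
  p.Monic ∧ p.natDegree = k ∧
    bernsteinOp n (polyFun p) = C (bernsteinEigenvalue n k) * p ∧
    (k = 1 → p = X - C (1 / 2))

/-- `p_k^{(n)}`, for `0 ≤ k ≤ n`. -/
def bernsteinEigenpoly (n k : ℕ) : ℝ[X] := Classical.epsilon (IsBernsteinEigenpoly n k)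

/-- `c` is the coefficient sequence of the expansion
`B_n f = ∑_{k=0}^n λ_k^{(n)} c_k p_k^{(n)}`, extended by zero beyond `n`. -/
def IsBernsteinExpansion (n : ℕ) (f : C(I, ℝ)) (c : ℕ → ℝ) : Prop :=
  bernsteinOp n f =
      ∑ k ∈ Finset.range (n + 1), C (bernsteinEigenvalue n k * c k) * bernsteinEigenpoly n k ∧
    ∀ k, n < k → c k = 0

/-- The dual functional `μ_k^{(n)}`, for `0 ≤ k ≤ n`. -/
def dualFunctional (n k : ℕ) (f : C(I, ℝ)) : ℝ := Classical.epsilon (IsBernsteinExpansion n f) k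

/-- The Jacobi polynomial `P_m^{(1,1)}`:
`P_m^{(1,1)}(z) = ∑_{s=0}^m binom(m+1,m-s) binom(m+1,s) ((z-1)/2)^s ((z+1)/2)^(m-s)`. -/
def jacobiOneOne (m : ℕ) : ℝ[X] :=
  ∑ s ∈ Finset.range (m + 1), C ((((m + 1).choose (m - s) * (m + 1).choose s : ℕ) : ℝ)) *
    (C (1 / 2) * (X - 1)) ^ s * (C (1 / 2) * (X + 1)) ^ (m - s)

/-- The Jacobi polynomial transplanted to `[0,1]`: `P_m^{(1,1)}(2x-1)`. -/
def shiftedJacobi (m : ℕ) : ℝ[X] := (jacobiOneOne m).comp (2 * X - 1)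

/-- The limit polynomials: `p_0^* = 1`, `p_1^* = x - 1/2` and
`p_k^* = k! (k-2)! / (2k-2)! * x (x-1) P_{k-2}^{(1,1)}(2x-1)` for `k ≥ 2`. -/
def limitPoly : ℕ → ℝ[X]
  | 0 => 1
  | 1 => X - C (1 / 2)
  | m + 2 => C (((m + 2).factorial * m.factorial : ℕ) / ((2 * m + 2).factorial : ℝ)) *
      (X * (X - 1) * shiftedJacobi m)

/-- The limit functionals on `C[0,1]`: `μ_0^*(f) = (f(0)+f(1))/2`, `μ_1^*(f) = f(1)-f(0)` and
`μ_k^*(f) = (1/2) binom(2k,k) ((-1)^k f(0) + f(1) - k ∫₀¹ f(x) P_{k-2}^{(1,1)}(2x-1) dx)`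
for `k ≥ 2`. -/
def limitFunctional : ℕ → C(I, ℝ) → ℝ
  | 0, f => (f 0 + f 1) / 2
  | 1, f => f 1 - f 0
  | m + 2, f => 1 / 2 * ((2 * (m + 2)).choose (m + 2) : ℝ) *
      ((-1) ^ (m + 2) * f 0 + f 1 -
        ((m + 2 : ℕ) : ℝ) * ∫ x : I, f x * (shiftedJacobi m).eval (x : ℝ))

/-- The Cooper-Waldron conjecture: `μ_k^{(n)}(f) → μ_k^*(f)` for all `k` and all `f ∈ C[0,1]`. -/
def CooperWaldronConjecture : Prop :=
  ∀ (k : ℕ) (f : C(I, ℝ)),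
    Tendsto (fun n : ℕ => dualFunctional n k f) atTop (𝓝 (limitFunctional k f))

/-- The function `λ_k^{(n)} μ_k^{(n)}(f) b_n^{-1}(p_k^{(n)})` of `C[0,1]`, where `b_n` is the Beta
operator. -/
def expansionTerm (n k : ℕ) (f : C(I, ℝ)) : C(I, ℝ) :=
  (bernsteinEigenvalue n k * dualFunctional n k f) • polyFun (betaInv n (bernsteinEigenpoly n k))

/-- The interchange of limits
`lim_n ∑_{k=0}^n T_{n,k} = ∑_{k=0}^∞ lim_n T_{n,k}` in `C[0,1]`, with `T_{n,k}` the term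
`expansionTerm n k f`: the termwise limits `G k` exist, and the series of the `G k` and the sums
on the left converge to the same function `S`. -/
def LimitsInterchange (f S : C(I, ℝ)) : Prop :=
  ∃ G : ℕ → C(I, ℝ),
    (∀ k, Tendsto (fun n : ℕ => expansionTerm n k f) atTop (𝓝 (G k))) ∧
    Tendsto (fun N : ℕ => ∑ k ∈ Finset.range N, G k) atTop (𝓝 S) ∧
    Tendsto (fun n : ℕ => ∑ k ∈ Finset.range (n + 1), expansionTerm n k f) atTop (𝓝 S)

end

noncomputable section

/-- Coefficientwise convergence of a sequence of real polynomials. -/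
def CoeffTendsto (p : ℕ → ℝ[X]) (q : ℝ[X]) : Prop :=
  ∀ i, Tendsto (fun n => (p n).coeff i) atTop (𝓝 (q.coeff i))

namespace CoeffTendsto

variable {p p' : ℕ → ℝ[X]} {q q' : ℝ[X]}

theorem const (q : ℝ[X]) : CoeffTendsto (fun _ => q) q := fun _ => tendsto_const_nhds

theorem congr' (h : CoeffTendsto p q) (he : ∀ᶠ n in atTop, p n = p' n) : CoeffTendsto p' q :=
  fun i => (h i).congr' (he.mono fun n hn => by rw [hn])

theorem add (h : CoeffTendsto p q) (h' : CoeffTendsto p' q') :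
    CoeffTendsto (fun n => p n + p' n) (q + q') := fun i => by
  simpa only [coeff_add] using (h i).add (h' i)

theorem sub (h : CoeffTendsto p q) (h' : CoeffTendsto p' q') :
    CoeffTendsto (fun n => p n - p' n) (q - q') := fun i => by
  simpa only [coeff_sub] using (h i).sub (h' i)

theorem neg (h : CoeffTendsto p q) : CoeffTendsto (fun n => -p n) (-q) := fun i => by
  simpa only [coeff_neg] using (h i).neg

theorem mul (h : CoeffTendsto p q) (h' : CoeffTendsto p' q') :
    CoeffTendsto (fun n => p n * p' n) (q * q') := fun i => by
  simp only [coeff_mul]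
  exact tendsto_finsetSum _ fun x _ => (h x.1).mul (h' x.2)

theorem sum {ι : Type*} (s : Finset ι) {p : ι → ℕ → ℝ[X]} {q : ι → ℝ[X]}
    (h : ∀ j ∈ s, CoeffTendsto (p j) (q j)) :
    CoeffTendsto (fun n => ∑ j ∈ s, p j n) (∑ j ∈ s, q j) := fun i => by
  simp only [finsetSum_coeff]
  exact tendsto_finsetSum _ fun j hj => h j hj i

theorem prod {ι : Type*} (s : Finset ι) {p : ι → ℕ → ℝ[X]} {q : ι → ℝ[X]}
    (h : ∀ j ∈ s, CoeffTendsto (p j) (q j)) :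
    CoeffTendsto (fun n => ∏ j ∈ s, p j n) (∏ j ∈ s, q j) := by
  classical
  induction s using Finset.induction_on with
  | empty => simpa using const 1
  | insert a s ha ih =>
    simp only [Finset.prod_insert ha]
    exact (h a (by simp)).mul (ih fun j hj => h j (by simp [hj]))

theorem smul {a : ℕ → ℝ} {b : ℝ} (ha : Tendsto a atTop (𝓝 b)) (h : CoeffTendsto p q) :
    CoeffTendsto (fun n => a n • p n) (b • q) := fun i => by
  simpa only [coeff_smul, smul_eq_mul] using ha.mul (h i)

theorem derivative (h : CoeffTendsto p q) :
    CoeffTendsto (fun n => Polynomial.derivative (p n)) (Polynomial.derivative q) := fun i => by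
  simpa only [coeff_derivative] using (h (i + 1)).mul_const _

theorem mem_degreeLT {m : ℕ} (h : CoeffTendsto p q) (hp : ∀ᶠ n in atTop, p n ∈ degreeLT ℝ m) :
    q ∈ degreeLT ℝ m := by
  rw [Polynomial.mem_degreeLT, degree_lt_iff_coeff_zero]
  intro i hi
  refine tendsto_nhds_unique (h i) (tendsto_const_nhds.congr' (hp.mono fun n hn => ?_))
  rw [Polynomial.mem_degreeLT, degree_lt_iff_coeff_zero] at hn
  exact (hn i hi).symm

end CoeffTendsto

theorem mem_degreeLT_iff_coeff {m : ℕ} {p : ℝ[X]} :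
    p ∈ degreeLT ℝ m ↔ ∀ i, m ≤ i → p.coeff i = 0 := by
  rw [mem_degreeLT, degree_lt_iff_coeff_zero]

theorem eq_zero_of_mem_degreeLT_zero {p : ℝ[X]} (hp : p ∈ degreeLT ℝ 0) : p = 0 := by
  ext i
  exact mem_degreeLT_iff_coeff.1 hp i (Nat.zero_le i)

theorem mem_degreeLT_succ_iff {m : ℕ} {p : ℝ[X]} :
    p ∈ degreeLT ℝ (m + 1) ↔ p.natDegree ≤ m := by
  rw [mem_degreeLT_iff_coeff, natDegree_le_iff_coeff_eq_zero]
  rfl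

theorem mem_degreeLE_iff {m : ℕ} {p : ℝ[X]} :
    p ∈ degreeLE ℝ m ↔ p ∈ degreeLT ℝ (m + 1) := by
  rw [mem_degreeLT_succ_iff, mem_degreeLE, natDegree_le_iff_degree_le]

theorem degreeLT_le_degreeLT {m k : ℕ} (h : m ≤ k) : degreeLT ℝ m ≤ degreeLT ℝ k := fun p hp => by
  rw [mem_degreeLT_iff_coeff] at *
  exact fun i hi => hp i (h.trans hi)

theorem sub_lead_mem_degreeLT {m : ℕ} {p : ℝ[X]} (hp : p ∈ degreeLT ℝ (m + 1)) :
    p - p.coeff m • X ^ m ∈ degreeLT ℝ m := by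
  rw [mem_degreeLT_iff_coeff] at *
  intro i hi
  rcases hi.eq_or_lt with rfl | hi
  · simp
  · simp [hp i hi, coeff_X_pow, hi.ne']

theorem sub_lead_mem_degreeLT' {m : ℕ} {p q : ℝ[X]} (hp : p ∈ degreeLT ℝ (m + 1))
    (hq : q ∈ degreeLT ℝ (m + 1)) (h : p.coeff m = q.coeff m) : p - q ∈ degreeLT ℝ m := by
  rw [mem_degreeLT_iff_coeff] at *
  intro i hi
  rcases hi.eq_or_lt with rfl | hi
  · simp [h]
  · simp [hp i hi, hq i hi]

theorem eq_sum_coeff_smul_X_pow {m : ℕ} {p : ℝ[X]} (hp : p ∈ degreeLT ℝ m) :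
    p = ∑ i ∈ Finset.range m, p.coeff i • X ^ i := by
  ext i
  simp only [finsetSum_coeff, coeff_smul, coeff_X_pow, smul_eq_mul, mul_ite, mul_one, mul_zero,
    Finset.sum_ite_eq, Finset.mem_range]
  split_ifs with hi
  · rfl
  · exact mem_degreeLT_iff_coeff.1 hp i (not_lt.1 hi)

theorem X_pow_mem_degreeLT (m : ℕ) : (X ^ m : ℝ[X]) ∈ degreeLT ℝ (m + 1) := by
  simp [mem_degreeLT_succ_iff]

section Triangular

/-- A linear operator on polynomials that does not raise the degree of monomials of degree less
than `m` maps `degreeLT ℝ m` to itself. -/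
theorem map_mem_degreeLT {T : ℝ[X] →ₗ[ℝ] ℝ[X]} {m : ℕ}
    (hT : ∀ d < m, T (X ^ d) ∈ degreeLT ℝ (d + 1)) {p : ℝ[X]} (hp : p ∈ degreeLT ℝ m) :
    T p ∈ degreeLT ℝ m := by
  induction m generalizing p with
  | zero =>
    simp [eq_zero_of_mem_degreeLT_zero hp]
  | succ m ih =>
    have h1 := ih (fun d hd => hT d (by omega)) (sub_lead_mem_degreeLT hp)
    have h2 : T p = T (p - p.coeff m • X ^ m) + p.coeff m • T (X ^ m) := by simp
    rw [h2]
    exact Submodule.add_mem _ (degreeLT_le_degreeLT (Nat.le_succ m) h1)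
      (Submodule.smul_mem _ _ (hT m (Nat.lt_succ_self m)))

theorem coeff_map_of_triangular {T : ℝ[X] →ₗ[ℝ] ℝ[X]} {m : ℕ}
    (hT : ∀ d ≤ m, T (X ^ d) ∈ degreeLT ℝ (d + 1)) {p : ℝ[X]} (hp : p ∈ degreeLT ℝ (m + 1)) :
    (T p).coeff m = p.coeff m * (T (X ^ m)).coeff m := by
  have h1 := map_mem_degreeLT (fun d hd => hT d hd.le) (sub_lead_mem_degreeLT hp)
  have h2 : T p = T (p - p.coeff m • X ^ m) + p.coeff m • T (X ^ m) := by simp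
  rw [h2, coeff_add, mem_degreeLT_iff_coeff.1 h1 m le_rfl]
  simp

/-- A triangular linear operator with nonzero diagonal is bijective on `degreeLT ℝ m`. -/
theorem existsUnique_of_triangular {T : ℝ[X] →ₗ[ℝ] ℝ[X]} {m : ℕ}
    (hT : ∀ d < m, T (X ^ d) ∈ degreeLT ℝ (d + 1)) (hc : ∀ d < m, (T (X ^ d)).coeff d ≠ 0)
    {p : ℝ[X]} (hp : p ∈ degreeLT ℝ m) : ∃! q, q ∈ degreeLT ℝ m ∧ T q = p := by
  induction m generalizing p with
  | zero =>
    exact ⟨0, ⟨Submodule.zero_mem _, by rw [map_zero, eq_zero_of_mem_degreeLT_zero hp]⟩,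
      fun q hq => eq_zero_of_mem_degreeLT_zero hq.1⟩
  | succ m ih =>
    have hTm := hT m (Nat.lt_succ_self m)
    have ht := hc m (Nat.lt_succ_self m)
    set a := p.coeff m / (T (X ^ m)).coeff m with ha
    have hr : p - a • T (X ^ m) ∈ degreeLT ℝ m :=
      sub_lead_mem_degreeLT' hp (Submodule.smul_mem _ _ hTm) (by simp [ha, ht])
    obtain ⟨q, ⟨hq, hTq⟩, hu⟩ :=
      ih (fun d hd => hT d (by omega)) (fun d hd => hc d (by omega)) hr
    refine ⟨q + a • X ^ m, ⟨Submodule.add_mem _ (degreeLT_le_degreeLT (Nat.le_succ m) hq)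
      (Submodule.smul_mem _ _ (X_pow_mem_degreeLT m)), by simp [hTq]⟩, ?_⟩
    rintro y ⟨hy, hTy⟩
    have h1 := coeff_map_of_triangular (fun d hd => hT d (by omega)) hy
    have h2 : y.coeff m = a := by rw [ha, ← hTy, h1]; field_simp
    have h3 := hu (y - a • X ^ m) ⟨h2 ▸ sub_lead_mem_degreeLT hy, by simp [hTy]⟩
    rw [← h3]; abel

/-- If triangular operators converge to one with nonzero diagonal, then so do preimages. -/
theorem CoeffTendsto.of_triangular {T : ℕ → ℝ[X] →ₗ[ℝ] ℝ[X]} {S : ℝ[X] →ₗ[ℝ] ℝ[X]} {m : ℕ}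
    (hTS : ∀ d < m, CoeffTendsto (fun n => T n (X ^ d)) (S (X ^ d)))
    (hT : ∀ d < m, ∀ᶠ n in atTop, T n (X ^ d) ∈ degreeLT ℝ (d + 1))
    (hc : ∀ d < m, (S (X ^ d)).coeff d ≠ 0) {q : ℕ → ℝ[X]} {r : ℝ[X]}
    (hq : ∀ᶠ n in atTop, q n ∈ degreeLT ℝ m) (hr : r ∈ degreeLT ℝ m)
    (h : CoeffTendsto (fun n => T n (q n)) (S r)) : CoeffTendsto q r := by
  induction m generalizing q r with
  | zero =>
    rw [eq_zero_of_mem_degreeLT_zero hr]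
    exact (CoeffTendsto.const 0).congr'
      (hq.mono fun n hn => (eq_zero_of_mem_degreeLT_zero hn).symm)
  | succ m ih =>
    have hS : ∀ d ≤ m, S (X ^ d) ∈ degreeLT ℝ (d + 1) := fun d hd =>
      (hTS d (by omega)).mem_degreeLT (hT d (by omega))
    have hTm : ∀ᶠ n in atTop, ∀ d ≤ m, T n (X ^ d) ∈ degreeLT ℝ (d + 1) := by
      have := (Filter.eventually_all_finset (Finset.range (m + 1))).2
        fun d hd => hT d (Finset.mem_range.1 hd)
      exact this.mono fun n hn d hd => hn d (Finset.mem_range.2 (by omega))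
    have hSm := hc m (Nat.lt_succ_self m)
    have ht := hTS m (Nat.lt_succ_self m) m
    have hlead : Tendsto (fun n => (q n).coeff m) atTop (𝓝 (r.coeff m)) := by
      have h1 := (h m).div ht hSm
      rw [coeff_map_of_triangular hS hr, mul_div_assoc, div_self hSm, mul_one] at h1
      refine h1.congr' ?_
      filter_upwards [hq, hTm, ht.eventually_ne hSm] with n hqn hTn htn
      simp only [Pi.div_apply]
      rw [coeff_map_of_triangular hTn hqn, mul_div_assoc, div_self htn, mul_one]
    have hX : CoeffTendsto (fun n => (q n).coeff m • (X ^ m : ℝ[X])) (r.coeff m • X ^ m) :=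
      (CoeffTendsto.const _).smul hlead
    have hrec : CoeffTendsto (fun n => q n - (q n).coeff m • X ^ m) (r - r.coeff m • X ^ m) := by
      refine ih (fun d hd => hTS d (by omega)) (fun d hd => hT d (by omega))
        (fun d hd => hc d (by omega)) (hq.mono fun n hn => sub_lead_mem_degreeLT hn)
        (sub_lead_mem_degreeLT hr) ?_
      have := h.sub ((hTS m (Nat.lt_succ_self m)).smul hlead)
      simpa only [map_sub, map_smul] using this
    simpa only [sub_add_cancel] using hrec.add hX

end Triangular

/-- `polyFun` as an algebra homomorphism. -/
def polyFunHom : ℝ[X] →ₐ[ℝ] C(I, ℝ) := toContinuousMapOnAlgHom I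

@[simp] theorem polyFun_apply (p : ℝ[X]) (x : I) : polyFun p x = p.eval (x : ℝ) := rfl

theorem polyFun_smul (a : ℝ) (p : ℝ[X]) : polyFun (a • p) = a • polyFun p :=
  map_smul polyFunHom a p

theorem polyFun_sum {ι : Type*} (s : Finset ι) (p : ι → ℝ[X]) :
    polyFun (∑ i ∈ s, p i) = ∑ i ∈ s, polyFun (p i) :=
  map_sum polyFunHom p s

theorem polyFun_injective : Function.Injective polyFun := fun p q h => by
  refine eq_of_infinite_eval_eq p q ((Set.Icc_infinite (zero_lt_one' ℝ)).mono fun x hx => ?_)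
  exact DFunLike.congr_fun h (⟨x, hx⟩ : I)

theorem CoeffTendsto.tendsto_polyFun {p : ℕ → ℝ[X]} {q : ℝ[X]} {m : ℕ} (h : CoeffTendsto p q)
    (hp : ∀ᶠ n in atTop, p n ∈ degreeLT ℝ m) :
    Tendsto (fun n => polyFun (p n)) atTop (𝓝 (polyFun q)) := by
  have key : ∀ r : ℝ[X], r ∈ degreeLT ℝ m →
      polyFun r = ∑ i ∈ Finset.range m, r.coeff i • polyFun (X ^ i) := fun r hr => by
    simp_rw [← polyFun_smul, ← polyFun_sum]
    rw [← eq_sum_coeff_smul_X_pow hr]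
  rw [key q (h.mem_degreeLT hp)]
  refine Tendsto.congr' (hp.mono fun n hn => (key _ hn).symm) ?_
  exact tendsto_finsetSum _ fun i _ => (h i).smul_const _

theorem X_mul_derivative_X_pow (k : ℕ) :
    X * derivative (X ^ k : ℝ[X]) = (k : ℝ[X]) * X ^ k := by
  cases k with
  | zero => simp
  | succ k => rw [derivative_X_pow]; simp; ring

theorem one_sub_X_mul_derivative_one_sub_X_pow (k : ℕ) :
    (1 - X) * derivative ((1 - X) ^ k : ℝ[X]) = -((k : ℝ[X]) * (1 - X) ^ k) := by
  cases k with
  | zero => simp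
  | succ k => rw [derivative_pow]; simp; ring

theorem X_mul_one_sub_X_mul_derivative_bernsteinPolynomial {n k : ℕ} (h : k ≤ n) :
    X * (1 - X) * derivative (bernsteinPolynomial ℝ n k) =
      ((k : ℝ[X]) - (n : ℝ[X]) * X) * bernsteinPolynomial ℝ n k := by
  have h1 := X_mul_derivative_X_pow k
  have h2 := one_sub_X_mul_derivative_one_sub_X_pow (n - k)
  have h3 : ((n - k : ℕ) : ℝ[X]) = n - k := by push_cast [h]; ring
  rw [h3] at h2
  simp only [bernsteinPolynomial, derivative_mul, derivative_natCast, zero_mul, zero_add]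
  linear_combination (n.choose k : ℝ[X]) * (1 - X) ^ (n - k) * (1 - X) * h1 +
    (n.choose k : ℝ[X]) * X ^ k * X * h2

/-- The Bernstein operator on polynomials. -/
def bernsteinLin (n : ℕ) : ℝ[X] →ₗ[ℝ] ℝ[X] where
  toFun p := bernsteinOp n (polyFun p)
  map_add' p q := by
    simp [bernsteinOp, add_mul, Finset.sum_add_distrib]
  map_smul' a p := by
    simp [bernsteinOp, smul_eq_C_mul, Finset.mul_sum, mul_assoc]

theorem bernsteinLin_apply (n : ℕ) (p : ℝ[X]) : bernsteinLin n p = bernsteinOp n (polyFun p) := rfl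

theorem bernsteinOp_mem_degreeLT (n : ℕ) (f : C(I, ℝ)) : bernsteinOp n f ∈ degreeLT ℝ (n + 1) := by
  refine Submodule.sum_mem _ fun k _ => ?_
  rw [← smul_eq_C_mul]
  refine Submodule.smul_mem _ _ ?_
  rw [mem_degreeLT_succ_iff, bernsteinPolynomial]
  have hk := k.is_le
  compute_degree
  omega

theorem bernsteinLin_one {n : ℕ} : bernsteinLin n 1 = 1 := by
  simp only [bernsteinLin_apply, bernsteinOp, polyFun_apply, eval_one, map_one, one_mul]
  rw [Fin.sum_univ_eq_sum_range (fun k => bernsteinPolynomial ℝ n k), bernsteinPolynomial.sum]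

theorem bernsteinLin_X_mul {n : ℕ} (hn : n ≠ 0) (p : ℝ[X]) :
    bernsteinLin n (X * p) = X * bernsteinLin n p +
      (n : ℝ)⁻¹ • (X * (1 - X) * derivative (bernsteinLin n p)) := by
  simp only [bernsteinLin_apply, bernsteinOp, polyFun_apply, derivative_sum, Finset.mul_sum,
    Finset.smul_sum, ← Finset.sum_add_distrib]
  refine Finset.sum_congr rfl fun k _ => ?_
  have h := X_mul_one_sub_X_mul_derivative_bernsteinPolynomial k.is_le
  have hC : (C (n : ℝ)⁻¹ : ℝ[X]) * (n : ℝ[X]) = 1 := by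
    rw [← C_eq_natCast, ← C_mul, inv_mul_cancel₀ (by exact_mod_cast hn), C_1]
  simp only [derivative_C_mul, eval_mul, eval_X, C_mul, bernstein.z, smul_eq_C_mul, div_eq_mul_inv,
    map_natCast]
  linear_combination -(C (n : ℝ)⁻¹ * C (eval ((k : ℝ) * (n : ℝ)⁻¹) p)) * h +
    C (eval ((k : ℝ) * (n : ℝ)⁻¹) p) * X * bernsteinPolynomial ℝ n k * hC

theorem bernsteinEigenvalue_zero (n : ℕ) : bernsteinEigenvalue n 0 = 1 := by
  simp [bernsteinEigenvalue]

theorem bernsteinEigenvalue_succ {n : ℕ} (hn : n ≠ 0) (k : ℕ) :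
    bernsteinEigenvalue n (k + 1) = bernsteinEigenvalue n k * (1 - k / n) := by
  have hn' : (n : ℝ) ≠ 0 := by exact_mod_cast hn
  rw [bernsteinEigenvalue, bernsteinEigenvalue, Nat.descFactorial_succ]
  rcases le_or_gt k n with h | h
  · push_cast [h]
    field_simp
    ring
  · simp [Nat.descFactorial_of_lt h]

theorem bernsteinEigenvalue_pos {n k : ℕ} (h : k ≤ n) : 0 < bernsteinEigenvalue n k := by
  have h1 : 0 < n.descFactorial k := Nat.descFactorial_pos.2 h
  rcases n.eq_zero_or_pos with rfl | hn
  · have : k = 0 := by omega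
    simp [this, bernsteinEigenvalue]
  · unfold bernsteinEigenvalue
    positivity

theorem bernsteinEigenvalue_one {n : ℕ} (hn : n ≠ 0) : bernsteinEigenvalue n 1 = 1 := by
  simp [bernsteinEigenvalue, hn]

theorem bernsteinEigenvalue_lt_of_lt {n k i : ℕ} (hi : i < k) (hk : 2 ≤ k) (hkn : k ≤ n) :
    bernsteinEigenvalue n k < bernsteinEigenvalue n i := by
  have hn : n ≠ 0 := by omega
  have hstep : ∀ m, 1 ≤ m → m + 1 ≤ n →
      bernsteinEigenvalue n (m + 1) < bernsteinEigenvalue n m := fun m hm hmn => by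
    rw [bernsteinEigenvalue_succ hn]
    have h1 := bernsteinEigenvalue_pos (show m ≤ n by omega)
    have h2 : (0 : ℝ) < m / n := by
      have : (0 : ℝ) < m := by exact_mod_cast hm
      have : (0 : ℝ) < n := by exact_mod_cast Nat.pos_of_ne_zero hn
      positivity
    nlinarith
  have hmain : ∀ k i, k ≤ n → 1 ≤ i → i < k →
      bernsteinEigenvalue n k < bernsteinEigenvalue n i := by
    intro k i hkn h1 hik
    induction k, hik using Nat.le_induction with
    | base => exact hstep i h1 hkn
    | succ m hm ih =>
      exact (hstep m (by omega) hkn).trans (ih (by omega))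
  rcases i.eq_zero_or_pos with rfl | h
  · rw [bernsteinEigenvalue_zero, ← bernsteinEigenvalue_one hn]
    exact hmain k 1 hkn le_rfl (by omega)
  · exact hmain k i hkn h hi

theorem tendsto_bernsteinEigenvalue (k : ℕ) :
    Tendsto (fun n => bernsteinEigenvalue n k) atTop (𝓝 1) := by
  induction k with
  | zero => simp [bernsteinEigenvalue_zero]
  | succ k ih =>
    have h : Tendsto (fun n : ℕ => bernsteinEigenvalue n k * (1 - k / n)) atTop
        (𝓝 (1 * (1 - 0))) :=
      ih.mul (tendsto_const_nhds.sub (tendsto_const_div_atTop_nhds_zero_nat _))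
    rw [sub_zero, mul_one] at h
    exact h.congr' ((eventually_ne_atTop 0).mono fun n hn => (bernsteinEigenvalue_succ hn k).symm)

theorem tendsto_natCast_mul_bernsteinEigenvalue_sub_one (k : ℕ) :
    Tendsto (fun n : ℕ => (n : ℝ) * (bernsteinEigenvalue n k - 1)) atTop
      (𝓝 (-(k * (k - 1) / 2))) := by
  induction k with
  | zero => simp [bernsteinEigenvalue_zero]
  | succ k ih =>
    have h := ih.sub ((tendsto_bernsteinEigenvalue k).const_mul (k : ℝ))
    have e : -((k : ℝ) * (k - 1) / 2) - k * 1 = -(((k + 1 : ℕ) : ℝ) * ((k + 1 : ℕ) - 1) / 2) := by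
      push_cast; ring
    rw [e] at h
    refine h.congr' ((eventually_ne_atTop 0).mono fun n hn => ?_)
    have hn' : (n : ℝ) ≠ 0 := by exact_mod_cast hn
    simp only [bernsteinEigenvalue_succ hn]
    field_simp
    ring

theorem bernsteinLin_X_pow_mem {n : ℕ} (hn : n ≠ 0) (d : ℕ) :
    bernsteinLin n (X ^ d) ∈ degreeLT ℝ (d + 1) := by
  rw [mem_degreeLT_succ_iff]
  induction d with
  | zero => simp [bernsteinLin_one]
  | succ d ih =>
    rw [pow_succ', bernsteinLin_X_mul hn]
    have h1 : (derivative (bernsteinLin n (X ^ d))).natDegree ≤ d - 1 :=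
      (natDegree_derivative_le _).trans (by omega)
    rcases d.eq_zero_or_pos with rfl | hd
    · simp [bernsteinLin_one]
    · compute_degree
      omega

theorem coeff_bernsteinLin_X_pow {n : ℕ} (hn : n ≠ 0) (d : ℕ) :
    (bernsteinLin n (X ^ d)).coeff d = bernsteinEigenvalue n d := by
  induction d with
  | zero => simp [bernsteinLin_one, bernsteinEigenvalue_zero]
  | succ d ih =>
    have h0 : (bernsteinLin n (X ^ d)).coeff (d + 1) = 0 :=
      mem_degreeLT_iff_coeff.1 (bernsteinLin_X_pow_mem hn d) _ le_rfl
    rw [pow_succ', bernsteinLin_X_mul hn, bernsteinEigenvalue_succ hn, mul_assoc, coeff_add,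
      coeff_smul, coeff_X_mul, coeff_X_mul, ih, sub_mul, one_mul, coeff_sub, coeff_derivative, h0]
    cases d with
    | zero => simp
    | succ d =>
      rw [coeff_X_mul, coeff_derivative, ih]
      push_cast
      simp
      ring

theorem coeffTendsto_bernsteinLin_X_pow (d : ℕ) :
    CoeffTendsto (fun n => bernsteinLin n (X ^ d)) (X ^ d) := by
  induction d with
  | zero => simpa [bernsteinLin_one] using CoeffTendsto.const 1
  | succ d ih =>
    have h := ((CoeffTendsto.const X).mul ih).add
      (((CoeffTendsto.const (X * (1 - X))).mul ih.derivative).smul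
        (tendsto_inv_atTop_nhds_zero_nat (𝕜 := ℝ)))
    rw [zero_smul, add_zero, ← pow_succ'] at h
    refine h.congr' ((eventually_ne_atTop 0).mono fun n hn => ?_)
    rw [pow_succ', bernsteinLin_X_mul hn]

/-- The differential operator `x (1 - x) / 2 * D ^ 2`. -/
def voronovskaja : ℝ[X] →ₗ[ℝ] ℝ[X] :=
  (LinearMap.mulLeft ℝ (C (1 / 2) * (X * (1 - X)) : ℝ[X])) ∘ₗ derivative ∘ₗ derivative

theorem voronovskaja_apply (p : ℝ[X]) :
    voronovskaja p = C (1 / 2) * (X * (1 - X)) * derivative (derivative p) := rfl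

theorem voronovskaja_X_pow_succ (d : ℕ) :
    voronovskaja (X ^ (d + 1)) =
      X * voronovskaja (X ^ d) + X * (1 - X) * derivative (X ^ d) := by
  have h2 : (C (1 / 2) : ℝ[X]) * 2 = 1 := by
    rw [← C_ofNat, ← C_mul]; norm_num
  simp only [voronovskaja_apply, pow_succ', derivative_mul, derivative_X, derivative_add, one_mul]
  linear_combination X * (1 - X) * derivative (X ^ d) * h2

theorem coeffTendsto_natCast_smul_bernsteinLin_sub (d : ℕ) :
    CoeffTendsto (fun n => (n : ℝ) • (bernsteinLin n (X ^ d) - X ^ d))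
      (voronovskaja (X ^ d)) := by
  induction d with
  | zero => simpa [bernsteinLin_one, voronovskaja_apply] using CoeffTendsto.const 0
  | succ d ih =>
    have h := ((CoeffTendsto.const X).mul ih).add
      ((CoeffTendsto.const (X * (1 - X))).mul (coeffTendsto_bernsteinLin_X_pow d).derivative)
    rw [← voronovskaja_X_pow_succ] at h
    refine h.congr' ((eventually_ne_atTop 0).mono fun n hn => ?_)
    rw [pow_succ', bernsteinLin_X_mul hn]
    have hn' : (n : ℝ) ≠ 0 := by exact_mod_cast hn
    rw [add_sub_right_comm, smul_add, smul_smul, mul_inv_cancel₀ hn', one_smul, ← mul_sub,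
      mul_smul_comm]

theorem coeff_voronovskaja_X_pow (d : ℕ) :
    (voronovskaja (X ^ d)).coeff d = -((d : ℝ) * (d - 1) / 2) := by
  refine tendsto_nhds_unique (coeffTendsto_natCast_smul_bernsteinLin_sub d d)
    ((tendsto_natCast_mul_bernsteinEigenvalue_sub_one d).congr' ?_)
  filter_upwards [eventually_ne_atTop 0] with n hn
  simp [coeff_bernsteinLin_X_pow hn]

theorem monic_natDegree_iff {p : ℝ[X]} {k : ℕ} :
    (p.Monic ∧ p.natDegree = k) ↔ p - X ^ k ∈ degreeLT ℝ k := by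
  constructor
  · rintro ⟨hp, rfl⟩
    exact sub_lead_mem_degreeLT' (mem_degreeLT_succ_iff.2 le_rfl) (X_pow_mem_degreeLT _)
      (by simp [hp.leadingCoeff])
  · intro h
    have h1 := degreeLT_le_degreeLT (Nat.le_succ k) h
    have h2 := Submodule.add_mem _ h1 (X_pow_mem_degreeLT k)
    rw [sub_add_cancel, mem_degreeLT_succ_iff] at h2
    have h3 : p.coeff k = 1 := by
      have := mem_degreeLT_iff_coeff.1 h k le_rfl
      simpa [sub_eq_zero] using this
    have h4 : p.Monic := monic_of_natDegree_le_of_coeff_eq_one k h2 h3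
    exact ⟨h4, le_antisymm h2 (le_natDegree_of_ne_zero (by simp [h3]))⟩

/-- The linear map on polynomials with prescribed values on the powers of `X`. -/
def monomialMap (e : ℕ → ℝ[X]) : ℝ[X] →ₗ[ℝ] ℝ[X] := (basisMonomials ℝ).constr ℝ e

@[simp] theorem monomialMap_X_pow (e : ℕ → ℝ[X]) (d : ℕ) : monomialMap e (X ^ d) = e d := by
  rw [X_pow_eq_monomial]
  exact (basisMonomials ℝ).constr_basis ℝ e d

theorem map_eq_sum_coeff_smul {V : Type*} [AddCommGroup V] [Module ℝ V] (T : ℝ[X] →ₗ[ℝ] V) {m : ℕ}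
    {p : ℝ[X]} (hp : p ∈ degreeLT ℝ m) :
    T p = ∑ i ∈ Finset.range m, p.coeff i • T (X ^ i) := by
  conv_lhs => rw [eq_sum_coeff_smul_X_pow hp]
  simp

theorem monomialMap_apply {e : ℕ → ℝ[X]} {m : ℕ} {p : ℝ[X]} (hp : p ∈ degreeLT ℝ m) :
    monomialMap e p = ∑ i ∈ Finset.range m, p.coeff i • e i := by
  simp [map_eq_sum_coeff_smul _ hp]

theorem isBernsteinEigenpoly_iff {n k : ℕ} {p : ℝ[X]} :
    IsBernsteinEigenpoly n k p ↔ p - X ^ k ∈ degreeLT ℝ k ∧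
      bernsteinLin n p = bernsteinEigenvalue n k • p ∧ (k = 1 → p = X - C (1 / 2)) := by
  rw [IsBernsteinEigenpoly, ← monic_natDegree_iff, and_assoc, bernsteinLin_apply, smul_eq_C_mul]

theorem existsUnique_isBernsteinEigenpoly {n k : ℕ} (hn : n ≠ 0) (hk : k ≤ n) :
    ∃! p : ℝ[X], IsBernsteinEigenpoly n k p := by
  simp only [isBernsteinEigenpoly_iff]
  rcases lt_or_ge k 2 with h | h
  · interval_cases k
    · refine ⟨1, ⟨by simp, ?_, by simp⟩, fun q hq =>
        sub_eq_zero.1 (by simpa using eq_zero_of_mem_degreeLT_zero hq.1)⟩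
      rw [bernsteinLin_one, bernsteinEigenvalue_zero, one_smul]
    · refine ⟨X - C (1 / 2), ⟨?_, ?_, fun _ => rfl⟩, fun q hq => hq.2.2 rfl⟩
      · rw [mem_degreeLT_succ_iff, pow_one, sub_sub_cancel_left, natDegree_neg, natDegree_C]
      · have hX : bernsteinLin n X = X := by
          have := bernsteinLin_X_mul hn 1
          simpa [bernsteinLin_one] using this
        have hC : (C (1 / 2) : ℝ[X]) = (1 / 2 : ℝ) • 1 := by rw [smul_eq_C_mul, mul_one]
        rw [hC, map_sub, map_smul, hX, bernsteinLin_one, bernsteinEigenvalue_one hn, one_smul]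
  · set T : ℝ[X] →ₗ[ℝ] ℝ[X] := bernsteinLin n - bernsteinEigenvalue n k • LinearMap.id with hT
    have hTa : ∀ p, T p = bernsteinLin n p - bernsteinEigenvalue n k • p := fun p => by simp [hT]
    have hTd : ∀ d, T (X ^ d) ∈ degreeLT ℝ (d + 1) := fun d => by
      rw [hTa]
      exact Submodule.sub_mem _ (bernsteinLin_X_pow_mem hn d)
        (Submodule.smul_mem _ _ (X_pow_mem_degreeLT d))
    have hTk : T (X ^ k) ∈ degreeLT ℝ k := by
      rw [hTa]
      refine sub_lead_mem_degreeLT' (bernsteinLin_X_pow_mem hn k)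
        (Submodule.smul_mem _ _ (X_pow_mem_degreeLT k)) ?_
      simp [coeff_bernsteinLin_X_pow hn]
    obtain ⟨r, ⟨hr, hTr⟩, hu⟩ := existsUnique_of_triangular (T := T) (fun d _ => hTd d)
      (fun d hd => by
        rw [hTa, coeff_sub, coeff_bernsteinLin_X_pow hn]
        simpa [sub_eq_zero] using (bernsteinEigenvalue_lt_of_lt hd h hk).ne') (neg_mem hTk)
    refine ⟨X ^ k + r, ⟨by simpa using hr, ?_, by omega⟩, ?_⟩
    · rw [← sub_eq_zero, ← hTa, map_add, hTr, add_neg_cancel]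
    · rintro q ⟨hq, hBq, -⟩
      rw [← hu (q - X ^ k) ⟨hq, by rw [map_sub, hTa q, hBq, sub_self, zero_sub]⟩]
      abel

theorem isBernsteinEigenpoly_bernsteinEigenpoly {n k : ℕ} (hn : n ≠ 0) (hk : k ≤ n) :
    IsBernsteinEigenpoly n k (bernsteinEigenpoly n k) :=
  Classical.epsilon_spec (existsUnique_isBernsteinEigenpoly hn hk).exists

theorem bernsteinEigenpoly_sub_mem {n k : ℕ} (hn : n ≠ 0) (hk : k ≤ n) :
    bernsteinEigenpoly n k - X ^ k ∈ degreeLT ℝ k :=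
  (isBernsteinEigenpoly_iff.1 (isBernsteinEigenpoly_bernsteinEigenpoly hn hk)).1

theorem bernsteinLin_bernsteinEigenpoly {n k : ℕ} (hn : n ≠ 0) (hk : k ≤ n) :
    bernsteinLin n (bernsteinEigenpoly n k) = bernsteinEigenvalue n k • bernsteinEigenpoly n k :=
  (isBernsteinEigenpoly_iff.1 (isBernsteinEigenpoly_bernsteinEigenpoly hn hk)).2.1

theorem bernsteinEigenpoly_mem {n k : ℕ} (hn : n ≠ 0) (hk : k ≤ n) :
    bernsteinEigenpoly n k ∈ degreeLT ℝ (k + 1) :=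
  mem_degreeLT_succ_iff.2 (isBernsteinEigenpoly_bernsteinEigenpoly hn hk).2.1.le

theorem coeff_bernsteinEigenpoly {n k : ℕ} (hn : n ≠ 0) (hk : k ≤ n) :
    (bernsteinEigenpoly n k).coeff k = 1 := by
  have := mem_degreeLT_iff_coeff.1 (bernsteinEigenpoly_sub_mem hn hk) k le_rfl
  simpa [sub_eq_zero] using this

theorem existsUnique_isBernsteinExpansion {n : ℕ} (hn : n ≠ 0) (f : C(I, ℝ)) :
    ∃! c : ℕ → ℝ, IsBernsteinExpansion n f c := by
  set e : ℕ → ℝ[X] := fun k => bernsteinEigenvalue n k • bernsteinEigenpoly n k with he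
  have key : ∀ q ∈ degreeLT ℝ (n + 1), monomialMap e q =
      ∑ k ∈ Finset.range (n + 1),
        C (bernsteinEigenvalue n k * q.coeff k) * bernsteinEigenpoly n k := fun q hq => by
    rw [monomialMap_apply hq]
    refine Finset.sum_congr rfl fun k _ => ?_
    rw [he, ← smul_eq_C_mul, smul_smul, mul_comm]
  obtain ⟨q, ⟨hq, hTq⟩, hu⟩ := existsUnique_of_triangular (T := monomialMap e) (m := n + 1)
    (fun d hd => by
      rw [monomialMap_X_pow]
      exact Submodule.smul_mem _ _ (bernsteinEigenpoly_mem hn (by omega)))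
    (fun d hd => by
      rw [monomialMap_X_pow, he]
      simp [coeff_bernsteinEigenpoly hn (show d ≤ n by omega),
        (bernsteinEigenvalue_pos (show d ≤ n by omega)).ne'])
    (bernsteinOp_mem_degreeLT n f)
  refine ⟨q.coeff, ⟨by rw [← key q hq, hTq], fun k hk => mem_degreeLT_iff_coeff.1 hq k hk⟩, ?_⟩
  rintro c ⟨hc, hc0⟩
  set y : ℝ[X] := ∑ k ∈ Finset.range (n + 1), c k • X ^ k with hy
  have hyc : ∀ k, y.coeff k = c k := fun k => by
    simp only [hy, finsetSum_coeff, coeff_smul, coeff_X_pow, smul_eq_mul, mul_ite, mul_one,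
      mul_zero, Finset.sum_ite_eq, Finset.mem_range]
    split_ifs with hk
    · rfl
    · exact (hc0 k (by omega)).symm
  have hym : y ∈ degreeLT ℝ (n + 1) :=
    mem_degreeLT_iff_coeff.2 fun i hi => by rw [hyc, hc0 i hi]
  rw [← hu y ⟨hym, by rw [key y hym, hc]; simp only [hyc]⟩]
  exact funext fun k => (hyc k).symm

theorem isBernsteinExpansion_dualFunctional {n : ℕ} (hn : n ≠ 0) (f : C(I, ℝ)) :
    IsBernsteinExpansion n f (fun k => dualFunctional n k f) :=
  Classical.epsilon_spec (existsUnique_isBernsteinExpansion hn f).exists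

/-- The dual functionals of a polynomial are its coordinates with respect to the
eigenpolynomials. -/
theorem exists_coeff_eq_dualFunctional {n m : ℕ} (hn : n ≠ 0) (hm : m ≤ n) {p : ℝ[X]}
    (hp : p ∈ degreeLT ℝ (m + 1)) :
    ∃ q ∈ degreeLT ℝ (m + 1), (∀ k, dualFunctional n k (polyFun p) = q.coeff k) ∧
      monomialMap (bernsteinEigenpoly n) q = p := by
  obtain ⟨q, ⟨hq, hTq⟩, -⟩ := existsUnique_of_triangular (T := monomialMap (bernsteinEigenpoly n))
    (m := m + 1) (fun d hd => by
      rw [monomialMap_X_pow]; exact bernsteinEigenpoly_mem hn (by omega))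
    (fun d hd => by simp [coeff_bernsteinEigenpoly hn (show d ≤ n by omega)]) hp
  refine ⟨q, hq, fun k => ?_, hTq⟩
  have hq' := degreeLT_le_degreeLT (Nat.succ_le_succ hm) hq
  refine congrFun ((existsUnique_isBernsteinExpansion hn (polyFun p)).unique
    (isBernsteinExpansion_dualFunctional hn _)
    ⟨?_, fun k hk => mem_degreeLT_iff_coeff.1 hq' k hk⟩) k
  rw [← bernsteinLin_apply, ← hTq, monomialMap_apply hq', map_sum]
  refine Finset.sum_congr rfl fun k hk => ?_
  rw [map_smul, bernsteinLin_bernsteinEigenpoly hn (by simpa [Nat.lt_succ_iff] using hk),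
    ← smul_eq_C_mul, smul_smul, mul_comm]

/-- The polynomial `x (x - 1)`. -/
def unitWeight : ℝ[X] := X * (X - 1)

/-- The Rodrigues polynomial `D ^ N (x (x - 1)) ^ N`, a multiple of the shifted Legendre
polynomial. -/
def rodrigues (N : ℕ) : ℝ[X] := derivative^[N] (unitWeight ^ N)

theorem monic_unitWeight : unitWeight.Monic := by
  have h := (monic_X (R := ℝ)).mul (monic_X_sub_C (1 : ℝ))
  rwa [C_1] at h

theorem natDegree_unitWeight : unitWeight.natDegree = 2 := by
  have h : (X - 1 : ℝ[X]).natDegree = 1 := by rw [← C_1, natDegree_X_sub_C]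
  have hm : (X - 1 : ℝ[X]).Monic := by rw [← C_1]; exact monic_X_sub_C 1
  rw [unitWeight, (monic_X (R := ℝ)).natDegree_mul hm, natDegree_X, h]

theorem natDegree_unitWeight_pow (N : ℕ) : (unitWeight ^ N).natDegree = 2 * N := by
  rw [monic_unitWeight.natDegree_pow, natDegree_unitWeight, mul_comm]

theorem unitWeight_ne_zero : unitWeight ≠ 0 := monic_unitWeight.ne_zero

theorem eval_unitWeight {x : ℝ} (hx : x = 0 ∨ x = 1) : unitWeight.eval x = 0 := by
  rcases hx with rfl | rfl <;> simp [unitWeight]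

theorem eval_iterate_derivative_unitWeight_pow {i N : ℕ} (h : i < N) {x : ℝ}
    (hx : x = 0 ∨ x = 1) : (derivative^[i] (unitWeight ^ N)).eval x = 0 := by
  obtain ⟨q, hq⟩ := pow_sub_dvd_iterate_derivative_pow unitWeight N i
  rw [hq, eval_mul, eval_pow, eval_unitWeight hx, zero_pow (by omega), zero_mul]

theorem factorial_mul_unitWeight_mul_shiftedJacobi (m : ℕ) :
    C (m.factorial : ℝ) * (unitWeight * shiftedJacobi m) =
      derivative^[m] (unitWeight ^ (m + 1)) := by
  have hJ : shiftedJacobi m = ∑ s ∈ Finset.range (m + 1),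
      C ((((m + 1).choose (m - s) * (m + 1).choose s : ℕ) : ℝ)) * (X - 1) ^ s * X ^ (m - s) := by
    rw [shiftedJacobi, jacobiOneOne, Polynomial.sum_comp]
    refine Finset.sum_congr rfl fun s _ => ?_
    have h2 : (C (1 / 2) : ℝ[X]) * 2 = 1 := by
      rw [← C_ofNat, ← C_mul]; norm_num
    have e1 : (C (1 / 2) : ℝ[X]) * (2 * X - 1 - 1) = X - 1 := by linear_combination (X - 1) * h2
    have e2 : (C (1 / 2) : ℝ[X]) * (2 * X - 1 + 1) = X := by linear_combination X * h2
    simp only [mul_comp, pow_comp, C_comp, sub_comp, add_comp, X_comp, one_comp, e1, e2]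
  have hw : unitWeight ^ (m + 1) = (X - C 1) ^ (m + 1) * X ^ (m + 1) := by
    rw [unitWeight, mul_pow, mul_comm, C_1]
  rw [hw, iterate_derivative_mul, hJ, Finset.mul_sum, Finset.mul_sum]
  refine Finset.sum_congr rfl fun s hs => ?_
  have hs : s ≤ m := by simpa [Nat.lt_succ_iff] using hs
  have hc : m.choose s * ((m + 1).descFactorial (m - s) * (m + 1).descFactorial s) =
      m.factorial * ((m + 1).choose (m - s) * (m + 1).choose s) := by
    rw [Nat.descFactorial_eq_factorial_mul_choose, Nat.descFactorial_eq_factorial_mul_choose,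
      ← Nat.choose_mul_factorial_mul_factorial hs]
    ring
  have hc' := congrArg (Nat.cast : ℕ → ℝ[X]) hc
  push_cast at hc'
  rw [iterate_derivative_X_sub_pow, iterate_derivative_X_pow_eq_natCast_mul,
    show m + 1 - (m - s) = s + 1 by omega, show m + 1 - s = m - s + 1 by omega, unitWeight]
  simp only [nsmul_eq_mul, C_1, Nat.cast_mul, C_mul, map_natCast]
  linear_combination -(X * (X - 1) * (X - 1) ^ s * X ^ (m - s)) * hc'

theorem iterate_derivative_unitWeight_mul (f : ℝ[X]) (k : ℕ) :
    derivative^[k + 2] (unitWeight * f) = unitWeight * derivative^[k + 2] f +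
      ((k : ℝ[X]) + 2) * (2 * X - 1) * derivative^[k + 1] f +
      ((k : ℝ[X]) + 2) * ((k : ℝ[X]) + 1) * derivative^[k] f := by
  induction k with
  | zero =>
    simp [unitWeight, Function.iterate_succ_apply']
    ring
  | succ k ih =>
    rw [Function.iterate_succ_apply', ih]
    simp only [Function.iterate_succ_apply', unitWeight, derivative_add, derivative_mul,
      derivative_natCast, derivative_X, derivative_sub, derivative_one, derivative_ofNat]
    push_cast
    ring

theorem iterate_derivative_two_X_sub_one_mul (f : ℝ[X]) (k : ℕ) :
    derivative^[k + 1] ((2 * X - 1) * f) = (2 * X - 1) * derivative^[k + 1] f +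
      2 * ((k : ℝ[X]) + 1) * derivative^[k] f := by
  induction k with
  | zero =>
    simp
    ring
  | succ k ih =>
    rw [Function.iterate_succ_apply', ih]
    simp only [Function.iterate_succ_apply', derivative_add, derivative_mul,
      derivative_natCast, derivative_X, derivative_sub, derivative_one, derivative_ofNat]
    push_cast
    ring

theorem unitWeight_mul_iterate_derivative (m : ℕ) :
    unitWeight * derivative^[m + 2] (unitWeight ^ (m + 1)) =
      ((m + 1) * (m + 2) : ℝ[X]) * derivative^[m] (unitWeight ^ (m + 1)) := by
  set y := unitWeight ^ (m + 1) with hy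
  have h0 : unitWeight * derivative y = ((m + 1 : ℕ) : ℝ[X]) * ((2 * X - 1) * y) := by
    rw [hy, derivative_pow_succ]
    simp only [unitWeight, derivative_mul, derivative_X, derivative_sub, derivative_one, map_add,
      map_natCast, map_one]
    push_cast
    ring
  have h1 := congrArg (fun p => derivative^[m + 2] p) h0
  simp only [iterate_derivative_natCast_mul] at h1
  rw [iterate_derivative_unitWeight_mul, iterate_derivative_two_X_sub_one_mul,
    ← Function.iterate_succ_apply, ← Function.iterate_succ_apply,
    ← Function.iterate_succ_apply] at h1
  have h2 : derivative (unitWeight * derivative^[m + 2] y -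
      ((m + 1) * (m + 2) : ℝ[X]) * derivative^[m] y) = 0 := by
    simp only [derivative_sub, derivative_mul, derivative_add, derivative_natCast, derivative_one,
      derivative_ofNat, ← Function.iterate_succ_apply' derivative]
    have h3 : derivative unitWeight = 2 * X - 1 := by
      simp [unitWeight]; ring
    rw [h3]
    simp only [Nat.succ_eq_add_one] at h1 ⊢
    push_cast at h1
    linear_combination h1
  have h3 := eq_C_of_derivative_eq_zero h2
  have h4 : (derivative^[m] y).eval 0 = 0 :=
    eval_iterate_derivative_unitWeight_pow (Nat.lt_succ_self m) (Or.inl rfl)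
  rw [coeff_zero_eq_eval_zero, eval_sub, eval_mul, eval_mul, h4, eval_unitWeight (Or.inl rfl),
    zero_mul, mul_zero, sub_zero, C_0, sub_eq_zero] at h3
  exact h3

theorem derivative_rodrigues_succ (m : ℕ) :
    derivative (rodrigues (m + 1)) = C ((m + 2).factorial : ℝ) * shiftedJacobi m := by
  refine mul_left_cancel₀ unitWeight_ne_zero ?_
  have h := unitWeight_mul_iterate_derivative m
  rw [← factorial_mul_unitWeight_mul_shiftedJacobi] at h
  rw [rodrigues, ← Function.iterate_succ_apply' derivative, h]
  simp only [Nat.factorial_succ, map_natCast]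
  push_cast
  ring

theorem limitPoly_add_two (m : ℕ) :
    limitPoly (m + 2) = C (((m + 2).factorial : ℝ) / (2 * m + 2).factorial) *
      derivative^[m] (unitWeight ^ (m + 1)) := by
  have h : (C (((m + 2).factorial * m.factorial : ℕ) / ((2 * m + 2).factorial : ℝ)) : ℝ[X]) =
      C (((m + 2).factorial : ℝ) / (2 * m + 2).factorial) * C (m.factorial : ℝ) := by
    rw [← C_mul]
    congr 1
    push_cast
    ring
  rw [← factorial_mul_unitWeight_mul_shiftedJacobi, limitPoly, h, unitWeight]
  ring

theorem derivative_limitPoly_add_two (m : ℕ) :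
    derivative (limitPoly (m + 2)) = C (((m + 2).factorial : ℝ) / (2 * m + 2).factorial) *
      rodrigues (m + 1) := by
  rw [limitPoly_add_two, derivative_C_mul, rodrigues, Function.iterate_succ_apply']

theorem eval_limitPoly_add_two (m : ℕ) {x : ℝ} (hx : x = 0 ∨ x = 1) :
    (limitPoly (m + 2)).eval x = 0 := by
  rw [limitPoly_add_two, eval_mul,
    eval_iterate_derivative_unitWeight_pow (Nat.lt_succ_self m) hx, mul_zero]

theorem limitPoly_sub_mem (k : ℕ) : limitPoly k - X ^ k ∈ degreeLT ℝ k := by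
  match k with
  | 0 => simp [limitPoly]
  | 1 =>
    rw [mem_degreeLT_succ_iff, pow_one, limitPoly, sub_sub_cancel_left, natDegree_neg, natDegree_C]
  | m + 2 =>
    refine sub_lead_mem_degreeLT' ?_ (X_pow_mem_degreeLT _) ?_
    · rw [mem_degreeLT_succ_iff, limitPoly_add_two]
      refine (natDegree_C_mul_le _ _).trans ((natDegree_iterate_derivative _ _).trans ?_)
      rw [natDegree_unitWeight_pow]
      omega
    · have h1 : (unitWeight ^ (m + 1)).coeff (m + 2 + m) = 1 := by
        have := (monic_unitWeight.pow (m + 1)).coeff_natDegree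
        rwa [natDegree_unitWeight_pow, show 2 * (m + 1) = m + 2 + m by omega] at this
      have h2 : ((m + 2).factorial : ℝ) * (m + 2 + m).descFactorial m = (2 * m + 2).factorial := by
        have := Nat.factorial_mul_descFactorial (show m ≤ m + 2 + m by omega)
        rw [show m + 2 + m - m = m + 2 by omega, show m + 2 + m = 2 * m + 2 by omega] at this
        rw [show m + 2 + m = 2 * m + 2 by omega]
        exact_mod_cast this
      rw [limitPoly_add_two, coeff_C_mul, coeff_iterate_derivative, h1, coeff_X_pow_self,
        nsmul_eq_mul, mul_one, div_mul_eq_mul_div, h2]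
      exact div_self (by positivity)

theorem limitPoly_mem (k : ℕ) : limitPoly k ∈ degreeLT ℝ (k + 1) := by
  have := Submodule.add_mem _ (degreeLT_le_degreeLT (Nat.le_succ k) (limitPoly_sub_mem k))
    (X_pow_mem_degreeLT k)
  rwa [sub_add_cancel] at this

theorem coeff_limitPoly (k : ℕ) : (limitPoly k).coeff k = 1 := by
  have := mem_degreeLT_iff_coeff.1 (limitPoly_sub_mem k) k le_rfl
  simpa [sub_eq_zero] using this

theorem voronovskaja_limitPoly (k : ℕ) :
    voronovskaja (limitPoly k) = (-((k : ℝ) * (k - 1) / 2)) • limitPoly k := by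
  match k with
  | 0 => simp [limitPoly, voronovskaja_apply]
  | 1 => simp [limitPoly, voronovskaja_apply]
  | m + 2 =>
    have h := unitWeight_mul_iterate_derivative m
    have hm : ((m : ℝ[X]) + 1) * (m + 2) = C (((m : ℝ) + 1) * (m + 2)) := by
      simp only [C_mul, C_add, C_1, C_ofNat, map_natCast]
    rw [hm] at h
    have hc : (-(((m + 2 : ℕ) : ℝ) * ((m + 2 : ℕ) - 1) / 2)) =
      -(1 / 2 * (((m : ℝ) + 1) * (m + 2))) := by push_cast; ring
    rw [voronovskaja_apply, hc, limitPoly_add_two, derivative_C_mul, derivative_C_mul,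
      ← Function.iterate_succ_apply' derivative, ← Function.iterate_succ_apply' derivative,
      smul_eq_C_mul, C_neg, C_mul]
    have hw : X * (1 - X) = -unitWeight := by rw [unitWeight]; ring
    rw [hw]
    linear_combination -C (1 / 2) * C (((m + 2).factorial : ℝ) / (2 * m + 2).factorial) * h

/-- The integral of a polynomial over `[0,1]`. -/
def unitIntegral : ℝ[X] →ₗ[ℝ] ℝ where
  toFun p := ∫ x in (0 : ℝ)..1, p.eval x
  map_add' p q := by
    simp only [eval_add]
    exact intervalIntegral.integral_add (p.continuous.intervalIntegrable _ _)
      (q.continuous.intervalIntegrable _ _)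
  map_smul' a p := by simp

theorem unitIntegral_derivative (p : ℝ[X]) :
    unitIntegral (derivative p) = p.eval 1 - p.eval 0 :=
  intervalIntegral.integral_eq_sub_of_hasDerivAt (fun x _ => p.hasDerivAt x)
    ((derivative p).continuous.intervalIntegrable _ _)

theorem unitIntegral_mul_derivative (p q : ℝ[X]) :
    unitIntegral (p * derivative q) =
      (p * q).eval 1 - (p * q).eval 0 - unitIntegral (derivative p * q) := by
  rw [← unitIntegral_derivative, derivative_mul, map_add]
  ring

theorem integral_unitInterval_eq (g : ℝ → ℝ) : ∫ x : I, g x = ∫ x in (0 : ℝ)..1, g x := by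
  rw [MeasureTheory.integral_subtype measurableSet_Icc g,
    MeasureTheory.integral_Icc_eq_integral_Ioc, intervalIntegral.integral_of_le zero_le_one]

theorem unitIntegral_mul_iterate_derivative {p : ℝ[X]} {j : ℕ}
    (hp : ∀ i < j, ∀ x : ℝ, x = 0 ∨ x = 1 → (derivative^[i] p).eval x = 0) (g : ℝ[X]) :
    unitIntegral (g * derivative^[j] p) = (-1) ^ j * unitIntegral (derivative^[j] g * p) := by
  induction j generalizing g with
  | zero => simp
  | succ j ih =>
    rw [Function.iterate_succ_apply', unitIntegral_mul_derivative, eval_mul, eval_mul,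
      hp j (Nat.lt_succ_self j) 1 (Or.inr rfl), hp j (Nat.lt_succ_self j) 0 (Or.inl rfl),
      ih (fun i hi => hp i (by omega)), Function.iterate_succ_apply, pow_succ]
    ring

theorem unitIntegral_mul_rodrigues (g : ℝ[X]) (N : ℕ) :
    unitIntegral (g * rodrigues N) =
      (-1) ^ N * unitIntegral (derivative^[N] g * unitWeight ^ N) :=
  unitIntegral_mul_iterate_derivative
    (fun _ hi _ hx => eval_iterate_derivative_unitWeight_pow hi hx) g

theorem unitIntegral_mul_rodrigues_of_lt {g : ℝ[X]} {N : ℕ} (h : g.natDegree < N) :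
    unitIntegral (g * rodrigues N) = 0 := by
  rw [unitIntegral_mul_rodrigues, iterate_derivative_eq_zero h, zero_mul, map_zero, mul_zero]

theorem natDegree_rodrigues_le (N : ℕ) : (rodrigues N).natDegree ≤ N := by
  refine (natDegree_iterate_derivative _ _).trans ?_
  rw [natDegree_unitWeight_pow]
  omega

theorem unitIntegral_rodrigues_mul_rodrigues {i j : ℕ} (h : i ≠ j) :
    unitIntegral (rodrigues i * rodrigues j) = 0 := by
  rcases lt_or_gt_of_ne h with h | h
  · exact unitIntegral_mul_rodrigues_of_lt ((natDegree_rodrigues_le i).trans_lt h)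
  · rw [mul_comm]
    exact unitIntegral_mul_rodrigues_of_lt ((natDegree_rodrigues_le j).trans_lt h)

theorem unitIntegral_X_pow_mul_X_sub_one_pow (a b : ℕ) :
    ((a + b + 1).factorial : ℝ) * unitIntegral (X ^ a * (X - 1) ^ b) =
      (-1) ^ b * a.factorial * b.factorial := by
  induction b generalizing a with
  | zero =>
    have h : (X ^ a : ℝ[X]) * (X - 1) ^ 0 = (1 / ((a : ℝ) + 1)) • derivative (X ^ (a + 1)) := by
      have ha : (a : ℝ) + 1 ≠ 0 := by positivity
      rw [derivative_X_pow, smul_eq_C_mul, ← mul_assoc, ← C_mul]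
      simp [ha]
    rw [h, map_smul, unitIntegral_derivative, add_zero, Nat.factorial_succ]
    have ha : (a : ℝ) + 1 ≠ 0 := by positivity
    simp
    field_simp
  | succ b ih =>
    have h := unitIntegral_derivative (X ^ (a + 1) * (X - 1) ^ (b + 1))
    have hd : derivative (X ^ (a + 1) * (X - 1 : ℝ[X]) ^ (b + 1)) =
        ((a : ℝ) + 1) • (X ^ a * (X - 1) ^ (b + 1)) +
          ((b : ℝ) + 1) • (X ^ (a + 1) * (X - 1) ^ b) := by
      simp [derivative_mul, derivative_pow_succ, smul_eq_C_mul]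
      ring
    rw [hd, map_add, map_smul, map_smul] at h
    have h2 := ih (a + 1)
    simp only [eval_mul, eval_pow, eval_X, eval_sub, eval_one, sub_self, ne_eq,
      Nat.add_eq_zero_iff, one_ne_zero, and_false, not_false_eq_true, zero_pow, mul_zero, zero_mul,
      smul_eq_mul] at h
    rw [show a + 1 + b + 1 = a + (b + 1) + 1 by ring] at h2
    have ha : (a : ℝ) + 1 ≠ 0 := by positivity
    refine mul_left_cancel₀ ha ?_
    rw [Nat.factorial_succ a] at h2
    rw [Nat.factorial_succ b, pow_succ (-1 : ℝ)]
    push_cast at h2 ⊢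
    linear_combination ((a + (b + 1) + 1).factorial : ℝ) * h - ((b : ℝ) + 1) * h2

theorem iterate_derivative_rodrigues (N : ℕ) :
    derivative^[N] (rodrigues N) = C ((2 * N).factorial : ℝ) := by
  rw [rodrigues, ← Function.iterate_add_apply, ← two_mul]
  have h : (derivative^[2 * N] (unitWeight ^ N)).natDegree = 0 := by
    have := natDegree_iterate_derivative (unitWeight ^ N) (2 * N)
    rw [natDegree_unitWeight_pow] at this
    omega
  rw [eq_C_of_natDegree_eq_zero h, coeff_iterate_derivative, zero_add, Nat.descFactorial_self]
  have h1 := (monic_unitWeight.pow N).coeff_natDegree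
  rw [natDegree_unitWeight_pow] at h1
  rw [h1, nsmul_eq_mul, mul_one]

theorem unitIntegral_rodrigues_sq (N : ℕ) :
    ((2 * N + 1).factorial : ℝ) * unitIntegral (rodrigues N * rodrigues N) =
      (2 * N).factorial * N.factorial ^ 2 := by
  have h := unitIntegral_X_pow_mul_X_sub_one_pow N N
  rw [← two_mul, ← mul_pow] at h
  have hs : ((-1 : ℝ) ^ N) * (-1) ^ N = 1 := by rw [← mul_pow]; simp
  rw [unitIntegral_mul_rodrigues, iterate_derivative_rodrigues, ← smul_eq_C_mul, map_smul,
    smul_eq_mul, unitWeight]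
  linear_combination (-1 : ℝ) ^ N * (2 * N).factorial * h + (2 * N).factorial * N.factorial ^ 2 * hs

theorem eval_rodrigues_one (N : ℕ) : (rodrigues N).eval 1 = N.factorial := by
  have h := aeval_iterate_derivative_self (A := ℝ) (unitWeight ^ N) N 1 (p' := X ^ N)
    (by simp [unitWeight, mul_pow, mul_comm])
  simpa [rodrigues] using h

theorem eval_rodrigues_zero (N : ℕ) : (rodrigues N).eval 0 = (-1) ^ N * N.factorial := by
  have h := aeval_iterate_derivative_self (A := ℝ) (unitWeight ^ N) N 0 (p' := (X - 1) ^ N)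
    (by simp [unitWeight, mul_pow])
  simpa [rodrigues, mul_comm] using h

theorem limitFunctional_add_two_polyFun (m : ℕ) (p : ℝ[X]) :
    limitFunctional (m + 2) (polyFun p) = 1 / 2 * ((2 * (m + 2)).choose (m + 2) : ℝ) /
      (m + 1).factorial * unitIntegral (derivative p * rodrigues (m + 1)) := by
  have hf : ((m + 1).factorial : ℝ) ≠ 0 := by positivity
  have h1 : ∫ x : I, polyFun p x * (shiftedJacobi m).eval (x : ℝ) =
      unitIntegral (p * shiftedJacobi m) := by
    rw [unitIntegral, LinearMap.coe_mk, AddHom.coe_mk]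
    simp only [eval_mul, polyFun_apply]
    exact integral_unitInterval_eq fun x => p.eval x * (shiftedJacobi m).eval x
  have h2 := unitIntegral_mul_derivative p (rodrigues (m + 1))
  have h3 : p * derivative (rodrigues (m + 1)) =
      ((m + 2).factorial : ℝ) • (p * shiftedJacobi m) := by
    rw [derivative_rodrigues_succ, smul_eq_C_mul]
    ring
  rw [h3, map_smul, smul_eq_mul, eval_mul, eval_mul, eval_rodrigues_one, eval_rodrigues_zero,
    Nat.factorial_succ (m + 1)] at h2
  have h4 : unitIntegral (derivative p * rodrigues (m + 1)) = (m + 1).factorial *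
      ((-1) ^ (m + 2) * p.eval 0 + p.eval 1 -
        ((m + 2 : ℕ) : ℝ) * unitIntegral (p * shiftedJacobi m)) := by
    push_cast at h2 ⊢
    linear_combination h2
  rw [limitFunctional, h1, h4]
  simp only [polyFun_apply, Set.Icc.coe_zero, Set.Icc.coe_one]
  field_simp

theorem limitFunctional_limitPoly (k j : ℕ) :
    limitFunctional k (polyFun (limitPoly j)) = if k = j then 1 else 0 := by
  match k, j with
  | 0, 0 => simp [limitFunctional, limitPoly]
  | 0, 1 => simp [limitFunctional, limitPoly]; norm_num
  | 1, 0 => simp [limitFunctional, limitPoly]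
  | 1, 1 => simp [limitFunctional, limitPoly]
  | 0, m + 2 => simp [limitFunctional, eval_limitPoly_add_two]
  | 1, m + 2 => simp [limitFunctional, eval_limitPoly_add_two]
  | m + 2, 0 => simp [limitFunctional_add_two_polyFun, limitPoly]
  | m + 2, 1 =>
    have h := unitIntegral_mul_rodrigues_of_lt (g := 1) (N := m + 1) (by simp)
    rw [one_mul] at h
    simp [limitFunctional_add_two_polyFun, limitPoly, h]
  | m + 2, i + 2 =>
    rw [limitFunctional_add_two_polyFun, derivative_limitPoly_add_two, mul_assoc, ← smul_eq_C_mul,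
      map_smul, smul_eq_mul]
    rcases eq_or_ne m i with rfl | h
    · have h := unitIntegral_rodrigues_sq (m + 1)
      have hc : (((2 * (m + 2)).choose (m + 2) : ℝ)) * (m + 2).factorial * (m + 2).factorial =
          (2 * (m + 2)).factorial := by
        have := Nat.choose_mul_factorial_mul_factorial (show m + 2 ≤ 2 * (m + 2) by omega)
        rw [show 2 * (m + 2) - (m + 2) = m + 2 by omega] at this
        exact_mod_cast this
      rw [show 2 * (m + 2) = 2 * (m + 1) + 1 + 1 by ring, Nat.factorial_succ (2 * (m + 1) + 1),
        Nat.factorial_succ (m + 1)] at hc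
      rw [if_pos rfl, show 2 * (m + 2) = 2 * (m + 1) + 1 + 1 by ring,
        show 2 * m + 2 = 2 * (m + 1) by ring, Nat.factorial_succ (m + 1)]
      have e1 : ((m + 1).factorial : ℝ) ≠ 0 := by positivity
      have e2 : ((2 * (m + 1)).factorial : ℝ) ≠ 0 := by positivity
      have e3 : ((2 * (m + 1) + 1).factorial : ℝ) ≠ 0 := by positivity
      have e4 : (m : ℝ) + 2 ≠ 0 := by positivity
      have h' : unitIntegral (rodrigues (m + 1) * rodrigues (m + 1)) =
          (2 * (m + 1)).factorial * (m + 1).factorial ^ 2 / (2 * (m + 1) + 1).factorial := by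
        rw [eq_div_iff e3, ← h]
        ring
      have hc' : ((2 * (m + 1) + 1 + 1).choose (m + 2) : ℝ) =
          2 * (2 * (m + 1) + 1).factorial / ((m + 2) * (m + 1).factorial ^ 2) := by
        rw [eq_div_iff (by positivity)]
        refine mul_left_cancel₀ e4 ?_
        push_cast at hc
        linear_combination hc
      rw [h', hc']
      push_cast
      field_simp
      ring
    · rw [unitIntegral_rodrigues_mul_rodrigues (by omega), if_neg (by omega), mul_zero, mul_zero]

theorem betaIntegrand_ofReal {a b t : ℝ} (ht0 : 0 ≤ t) (ht1 : t ≤ 1) :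
    ((t : ℂ) ^ ((a : ℂ) - 1) * (1 - (t : ℂ)) ^ ((b : ℂ) - 1)) =
      ((t ^ (a - 1) * (1 - t) ^ (b - 1) : ℝ) : ℂ) := by
  rw [Complex.ofReal_mul, Complex.ofReal_cpow ht0, Complex.ofReal_cpow (sub_nonneg.2 ht1)]
  push_cast
  rfl

theorem intervalIntegrable_betaIntegrand {a b : ℝ} (ha : 0 < a) (hb : 0 < b) :
    IntervalIntegrable (fun t : ℝ => t ^ (a - 1) * (1 - t) ^ (b - 1)) MeasureTheory.volume 0 1 := by
  have h := Complex.betaIntegral_convergent (u := (a : ℂ)) (v := (b : ℂ)) (by simpa) (by simpa)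
  rw [intervalIntegrable_iff_integrableOn_Ioc_of_le zero_le_one] at h ⊢
  refine MeasureTheory.IntegrableOn.congr_fun h.re (fun t ht => ?_) measurableSet_Ioc
  simp only [betaIntegrand_ofReal (a := a) (b := b) ht.1.le ht.2]
  exact Complex.ofReal_re _

theorem integral_betaIntegrand {a b : ℝ} (ha : 0 < a) (hb : 0 < b) :
    ∫ t in (0 : ℝ)..1, t ^ (a - 1) * (1 - t) ^ (b - 1) = ProbabilityTheory.beta a b := by
  rw [ProbabilityTheory.beta_eq_betaIntegralReal a b ha hb, Complex.betaIntegral]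
  have h : ∫ t in (0 : ℝ)..1, (t : ℂ) ^ ((a : ℂ) - 1) * (1 - (t : ℂ)) ^ ((b : ℂ) - 1) =
      ∫ t in (0 : ℝ)..1, ((t ^ (a - 1) * (1 - t) ^ (b - 1) : ℝ) : ℂ) := by
    refine intervalIntegral.integral_congr fun t ht => ?_
    rw [Set.uIcc_of_le zero_le_one] at ht
    exact betaIntegrand_ofReal ht.1 ht.2
  rw [h, intervalIntegral.integral_ofReal, Complex.ofReal_re]

theorem Gamma_add_natCast {a : ℝ} (ha : 0 < a) (d : ℕ) :
    Real.Gamma (a + d) = (∏ i ∈ Finset.range d, (a + i)) * Real.Gamma a := by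
  induction d with
  | zero => simp
  | succ d ih =>
    have h : a + d ≠ 0 := by positivity
    rw [Nat.cast_succ, ← add_assoc, Real.Gamma_add_one h, ih, Finset.prod_range_succ]
    ring

theorem beta_add_natCast_div {a b : ℝ} (ha : 0 < a) (hb : 0 < b) (d : ℕ) :
    ProbabilityTheory.beta (a + d) b / ProbabilityTheory.beta a b =
      ∏ i ∈ Finset.range d, (a + i) / (a + b + i) := by
  have h1 := Real.Gamma_pos_of_pos ha
  have h2 := Real.Gamma_pos_of_pos hb
  have h3 := Real.Gamma_pos_of_pos (add_pos ha hb)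
  have h4 : 0 < ∏ i ∈ Finset.range d, (a + b + i) := Finset.prod_pos fun i _ => by positivity
  rw [ProbabilityTheory.beta, ProbabilityTheory.beta, add_right_comm, Gamma_add_natCast ha,
    Gamma_add_natCast (add_pos ha hb), Finset.prod_div_distrib]
  field_simp

/-- The image of `X ^ d` under the Beta operator. -/
def betaMonomial (n d : ℕ) : ℝ[X] :=
  ∏ i ∈ Finset.range d, (C ((n : ℝ) / (n + i)) * X + C ((i : ℝ) / (n + i)))

/-- The Beta operator on polynomials. -/
def betaLin (n : ℕ) : ℝ[X] →ₗ[ℝ] ℝ[X] := monomialMap (betaMonomial n)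

theorem eval_betaMonomial (n d : ℕ) (x : ℝ) :
    (betaMonomial n d).eval x = ∏ i ∈ Finset.range d, (n * x + i) / (n + i) := by
  rw [betaMonomial, eval_prod]
  refine Finset.prod_congr rfl fun i _ => ?_
  simp
  ring

theorem natDegree_betaMonomial_factor_le (n i : ℕ) :
    (C ((n : ℝ) / (n + i)) * X + C ((i : ℝ) / (n + i))).natDegree ≤ 1 := by
  compute_degree

theorem betaMonomial_mem (n d : ℕ) : betaMonomial n d ∈ degreeLT ℝ (d + 1) := by
  rw [mem_degreeLT_succ_iff]
  refine (natDegree_prod_le _ _).trans ((Finset.sum_le_sum fun i _ =>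
    natDegree_betaMonomial_factor_le n i).trans ?_)
  simp

theorem coeff_betaMonomial_ne_zero {n : ℕ} (hn : n ≠ 0) (d : ℕ) :
    (betaMonomial n d).coeff d ≠ 0 := by
  have h := coeff_prod_of_natDegree_le (Finset.range d) _ 1
    fun i _ => natDegree_betaMonomial_factor_le n i
  rw [Finset.card_range, mul_one] at h
  rw [betaMonomial, h, Finset.prod_ne_zero_iff]
  intro i _
  have : (0 : ℝ) < n := by exact_mod_cast Nat.pos_of_ne_zero hn
  simp only [coeff_add, coeff_C_mul, coeff_X_one, mul_one, coeff_C_succ, add_zero]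
  positivity

theorem coeffTendsto_betaMonomial (d : ℕ) : CoeffTendsto (fun n => betaMonomial n d) (X ^ d) := by
  have h : CoeffTendsto (fun n => betaMonomial n d) (∏ i ∈ Finset.range d, X) := by
    refine CoeffTendsto.prod _ fun i _ => ?_
    have h1 : Tendsto (fun n : ℕ => (i : ℝ) / (n + i)) atTop (𝓝 0) :=
      tendsto_const_nhds.div_atTop
        (tendsto_atTop_add_const_right _ _ tendsto_natCast_atTop_atTop)
    have h2 : Tendsto (fun n : ℕ => (n : ℝ) / (n + i)) atTop (𝓝 1) := by
      have := h1.const_sub 1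
      rw [sub_zero] at this
      refine this.congr' ((eventually_ne_atTop 0).mono fun n hn => ?_)
      have : (n : ℝ) + i ≠ 0 := by
        have : (0 : ℝ) < n := by exact_mod_cast Nat.pos_of_ne_zero hn
        positivity
      field_simp
      ring
    have h3 := ((CoeffTendsto.const X).smul h2).add ((CoeffTendsto.const 1).smul h1)
    simpa [smul_eq_C_mul] using h3
  simpa using h

theorem betaOp_polyFun_of_mem_Ioo (n : ℕ) (p : ℝ[X]) {x : I} (h0 : x ≠ 0) (h1 : x ≠ 1) :
    betaOp n (polyFun p) x = (∫ t in (0 : ℝ)..1,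
      t ^ (n * (x : ℝ) - 1) * (1 - t) ^ (n * (1 - (x : ℝ)) - 1) * p.eval t) /
        ProbabilityTheory.beta (n * (x : ℝ)) (n * (1 - (x : ℝ))) := by
  rw [betaOp, if_neg h0, if_neg h1, ← integral_unitInterval_eq]
  rfl

theorem betaOp_polyFun {n : ℕ} (hn : n ≠ 0) (p : ℝ[X]) :
    betaOp n (polyFun p) = polyFun (betaLin n p) := by
  have hn' : (0 : ℝ) < n := by exact_mod_cast Nat.pos_of_ne_zero hn
  funext x
  rw [polyFun_apply]
  induction p using Polynomial.induction_on' with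
  | add p q hp hq =>
    rw [map_add, eval_add, ← hp, ← hq]
    by_cases h0 : x = 0
    · simp [betaOp, h0]
    by_cases h1 : x = 1
    · simp [betaOp, h1]
    have ha : 0 < n * (x : ℝ) := mul_pos hn' (unitInterval.pos_iff_ne_zero.2 h0)
    have hb : 0 < n * (1 - (x : ℝ)) :=
      mul_pos hn' (sub_pos.2 (unitInterval.lt_one_iff_ne_one.2 h1))
    have hi : ∀ r : ℝ[X], IntervalIntegrable (fun t : ℝ => t ^ (n * (x : ℝ) - 1) *
        (1 - t) ^ (n * (1 - (x : ℝ)) - 1) * r.eval t) MeasureTheory.volume 0 1 := fun r =>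
      (intervalIntegrable_betaIntegrand ha hb).mul_continuousOn r.continuous.continuousOn
    simp only [betaOp_polyFun_of_mem_Ioo _ _ h0 h1]
    rw [← add_div, ← intervalIntegral.integral_add (hi p) (hi q)]
    simp only [eval_add, mul_add]
  | monomial d c =>
    have hX : betaLin n (monomial d c) = c • betaMonomial n d := by
      rw [← smul_X_eq_monomial, map_smul, betaLin, monomialMap_X_pow]
    rw [hX, eval_smul, eval_betaMonomial, smul_eq_mul]
    by_cases h0 : x = 0
    · cases d with
      | zero => simp [betaOp, h0]
      | succ d => simp [betaOp, h0, Finset.prod_range_succ']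
    by_cases h1 : x = 1
    · have : ∏ i ∈ Finset.range d, ((n : ℝ) * ((1 : I) : ℝ) + i) / (n + i) = 1 :=
        Finset.prod_eq_one fun i _ => by
          rw [Set.Icc.coe_one, mul_one]
          exact div_self (by positivity)
      rw [h1, this]
      simp [betaOp]
    have ha : 0 < n * (x : ℝ) := mul_pos hn' (unitInterval.pos_iff_ne_zero.2 h0)
    have hb : 0 < n * (1 - (x : ℝ)) :=
      mul_pos hn' (sub_pos.2 (unitInterval.lt_one_iff_ne_one.2 h1))
    have hint : (∫ t in (0 : ℝ)..1, t ^ (n * (x : ℝ) - 1) * (1 - t) ^ (n * (1 - (x : ℝ)) - 1) *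
        (monomial d c).eval t) = c * ProbabilityTheory.beta (n * (x : ℝ) + d)
          (n * (1 - (x : ℝ))) := by
      rw [← integral_betaIntegrand (by positivity) hb, ← intervalIntegral.integral_const_mul,
        intervalIntegral.integral_of_le zero_le_one, intervalIntegral.integral_of_le zero_le_one]
      refine MeasureTheory.setIntegral_congr_fun measurableSet_Ioc fun t ht => ?_
      simp only [eval_monomial]
      rw [show n * (x : ℝ) + d - 1 = n * (x : ℝ) - 1 + d by ring, Real.rpow_add ht.1,
        Real.rpow_natCast]
      ring
    have hs : (n : ℝ) * x + n * (1 - x) = n := by ring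
    rw [betaOp_polyFun_of_mem_Ioo _ _ h0 h1, hint, mul_div_assoc, beta_add_natCast_div ha hb, hs]

theorem isBetaPreimage_iff {n : ℕ} (hn : n ≠ 0) {p q : ℝ[X]} :
    IsBetaPreimage n p q ↔ q ∈ degreeLT ℝ (n + 1) ∧ betaLin n q = p := by
  rw [IsBetaPreimage, betaOp_polyFun hn, mem_degreeLE_iff, DFunLike.coe_fn_eq,
    polyFun_injective.eq_iff]

theorem existsUnique_isBetaPreimage' {n m : ℕ} (hn : n ≠ 0) {p : ℝ[X]} (hp : p ∈ degreeLT ℝ m) :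
    ∃! q, q ∈ degreeLT ℝ m ∧ betaLin n q = p :=
  existsUnique_of_triangular
    (fun d _ => by rw [betaLin, monomialMap_X_pow]; exact betaMonomial_mem n d)
    (fun d _ => by rw [betaLin, monomialMap_X_pow]; exact coeff_betaMonomial_ne_zero hn d) hp

theorem existsUnique_isBetaPreimage {n : ℕ} (hn : n ≠ 0) {p : ℝ[X]}
    (hp : p ∈ degreeLT ℝ (n + 1)) : ∃! q, IsBetaPreimage n p q := by
  simp only [isBetaPreimage_iff hn]
  exact existsUnique_isBetaPreimage' hn hp

theorem betaInv_eq {n : ℕ} (hn : n ≠ 0) {q : ℝ[X]} (hq : q ∈ degreeLT ℝ (n + 1)) :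
    betaInv n (betaLin n q) = q := by
  have h : IsBetaPreimage n (betaLin n q) q := (isBetaPreimage_iff hn).2 ⟨hq, rfl⟩
  have hp : betaLin n q ∈ degreeLT ℝ (n + 1) := map_mem_degreeLT
    (fun d _ => by rw [betaLin, monomialMap_X_pow]; exact betaMonomial_mem n d) hq
  exact (existsUnique_isBetaPreimage hn hp).unique (Classical.epsilon_spec ⟨q, h⟩) h

theorem betaInv_spec {n m : ℕ} (hn : n ≠ 0) (hm : m ≤ n) {p : ℝ[X]}
    (hp : p ∈ degreeLT ℝ (m + 1)) :
    betaInv n p ∈ degreeLT ℝ (m + 1) ∧ betaLin n (betaInv n p) = p := by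
  obtain ⟨q, ⟨hq, rfl⟩, -⟩ := existsUnique_isBetaPreimage' hn hp
  rw [betaInv_eq hn (degreeLT_le_degreeLT (Nat.succ_le_succ hm) hq)]
  exact ⟨hq, rfl⟩

theorem betaInv_sum_smul {n : ℕ} (hn : n ≠ 0) {ι : Type*} (s : Finset ι) (c : ι → ℝ)
    {p : ι → ℝ[X]} (hp : ∀ k ∈ s, p k ∈ degreeLT ℝ (n + 1)) :
    betaInv n (∑ k ∈ s, c k • p k) = ∑ k ∈ s, c k • betaInv n (p k) := by
  have h : ∑ k ∈ s, c k • p k = betaLin n (∑ k ∈ s, c k • betaInv n (p k)) := by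
    rw [map_sum]
    refine Finset.sum_congr rfl fun k hk => ?_
    rw [map_smul, (betaInv_spec hn le_rfl (hp k hk)).2]
  rw [h]
  exact betaInv_eq hn (Submodule.sum_mem _ fun k hk =>
    Submodule.smul_mem _ _ (betaInv_spec hn le_rfl (hp k hk)).1)

theorem coeffTendsto_bernsteinEigenpoly (s : ℕ) :
    CoeffTendsto (fun n => bernsteinEigenpoly n s) (limitPoly s) := by
  have hev : ∀ᶠ n : ℕ in atTop, n ≠ 0 ∧ s ≤ n :=
    (eventually_ne_atTop 0).and (eventually_ge_atTop s)
  rcases lt_or_ge s 2 with h | h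
  · refine (CoeffTendsto.const (limitPoly s)).congr' (hev.mono fun n hn => ?_)
    have hs := isBernsteinEigenpoly_bernsteinEigenpoly hn.1 hn.2
    interval_cases s
    · exact (eq_one_of_monic_natDegree_zero hs.1 hs.2.1).symm
    · exact (hs.2.2.2 rfl).symm
  set T : ℕ → ℝ[X] →ₗ[ℝ] ℝ[X] := fun n => (n : ℝ) • (bernsteinLin n - LinearMap.id) -
    ((n : ℝ) * (bernsteinEigenvalue n s - 1)) • LinearMap.id with hT
  set S : ℝ[X] →ₗ[ℝ] ℝ[X] := voronovskaja - (-((s : ℝ) * (s - 1) / 2)) • LinearMap.id with hS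
  have hTa : ∀ n p, T n p = (n : ℝ) • (bernsteinLin n p - p) -
      ((n : ℝ) * (bernsteinEigenvalue n s - 1)) • p := fun n p => rfl
  have hSa : ∀ p, S p = voronovskaja p - (-((s : ℝ) * (s - 1) / 2)) • p := fun p => rfl
  have hTS : ∀ d, CoeffTendsto (fun n => T n (X ^ d)) (S (X ^ d)) := fun d =>
    (coeffTendsto_natCast_smul_bernsteinLin_sub d).sub
      ((CoeffTendsto.const _).smul (tendsto_natCast_mul_bernsteinEigenvalue_sub_one s))
  have hmain : CoeffTendsto (fun n => bernsteinEigenpoly n s - X ^ s) (limitPoly s - X ^ s) := by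
    refine CoeffTendsto.of_triangular (T := T) (S := S) (m := s) (fun d _ => hTS d) ?_ ?_
      (hev.mono fun n hn => bernsteinEigenpoly_sub_mem hn.1 hn.2) (limitPoly_sub_mem s) ?_
    · intro d _
      filter_upwards [eventually_ne_atTop 0] with n hn
      rw [hTa]
      exact Submodule.sub_mem _ (Submodule.smul_mem _ _
        (Submodule.sub_mem _ (bernsteinLin_X_pow_mem hn d) (X_pow_mem_degreeLT d)))
        (Submodule.smul_mem _ _ (X_pow_mem_degreeLT d))
    · intro d hd
      rw [hSa, coeff_sub, coeff_voronovskaja_X_pow, coeff_smul, coeff_X_pow_self, smul_eq_mul]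
      have h1 : (d : ℝ) + 1 ≤ s := by exact_mod_cast hd
      have h2 : (2 : ℝ) ≤ s := by exact_mod_cast h
      have h3 : (0 : ℝ) ≤ d := by positivity
      nlinarith [mul_nonneg h3 (sub_nonneg.2 h1)]
    · have h1 : S (limitPoly s - X ^ s) = -S (X ^ s) := by
        rw [map_sub, hSa (limitPoly s), voronovskaja_limitPoly, sub_self, zero_sub]
      rw [h1]
      refine (hTS s).neg.congr' (hev.mono fun n hn => ?_)
      have h2 : T n (bernsteinEigenpoly n s) = 0 := by
        rw [hTa, bernsteinLin_bernsteinEigenpoly hn.1 hn.2]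
        module
      rw [map_sub, h2, zero_sub]
  simpa using hmain.add (CoeffTendsto.const (X ^ s))

/-- The limit functional on polynomials as a linear map. -/
def limitFunctionalLin (k : ℕ) : ℝ[X] →ₗ[ℝ] ℝ where
  toFun p := limitFunctional k (polyFun p)
  map_add' p q := by
    match k with
    | 0 => simp [limitFunctional]; ring
    | 1 => simp [limitFunctional]; ring
    | m + 2 => simp only [limitFunctional_add_two_polyFun, map_add, add_mul, mul_add]
  map_smul' a p := by
    match k with
    | 0 => simp [limitFunctional]; ring
    | 1 => simp [limitFunctional]; ring
    | m + 2 =>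
      simp only [limitFunctional_add_two_polyFun, smul_mul_assoc, map_smul,
        smul_eq_mul, RingHom.id_apply]
      ring

theorem limitFunctionalLin_apply (k : ℕ) (p : ℝ[X]) :
    limitFunctionalLin k p = limitFunctional k (polyFun p) := rfl

theorem tendsto_dualFunctional_polyFun (k : ℕ) (p : ℝ[X]) :
    Tendsto (fun n => dualFunctional n k (polyFun p)) atTop
      (𝓝 (limitFunctional k (polyFun p))) := by
  have hp : p ∈ degreeLT ℝ (p.natDegree + 1) := mem_degreeLT_succ_iff.2 le_rfl
  set m := p.natDegree with hm
  have hev : ∀ᶠ n : ℕ in atTop, n ≠ 0 ∧ m ≤ n :=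
    (eventually_ne_atTop 0).and (eventually_ge_atTop m)
  choose! q hq hqc hqp using fun (n : ℕ) (hn : n ≠ 0 ∧ m ≤ n) =>
    exists_coeff_eq_dualFunctional hn.1 hn.2 hp
  obtain ⟨r, ⟨hr, hrp⟩, -⟩ := existsUnique_of_triangular (T := monomialMap limitPoly)
    (m := m + 1) (fun d _ => by rw [monomialMap_X_pow]; exact limitPoly_mem d)
    (fun d _ => by simp [coeff_limitPoly]) hp
  have hconv : CoeffTendsto q r := by
    refine CoeffTendsto.of_triangular (T := fun n => monomialMap (bernsteinEigenpoly n))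
      (S := monomialMap limitPoly) (m := m + 1) (fun d _ => ?_) (fun d _ => ?_) (fun d _ => ?_)
      (hev.mono hq) hr ?_
    · simpa using coeffTendsto_bernsteinEigenpoly d
    · filter_upwards [eventually_ne_atTop 0, eventually_ge_atTop d] with n hn hd
      rw [monomialMap_X_pow]
      exact bernsteinEigenpoly_mem hn hd
    · simp [coeff_limitPoly]
    · rw [hrp]
      exact (CoeffTendsto.const p).congr' (hev.mono fun n hn => (hqp n hn).symm)
  have hk : limitFunctional k (polyFun p) = r.coeff k := by
    rw [← hrp, monomialMap_apply hr, ← limitFunctionalLin_apply, map_sum]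
    simp only [map_smul, limitFunctionalLin_apply, limitFunctional_limitPoly, smul_eq_mul, mul_ite,
      mul_one, mul_zero, Finset.sum_ite_eq, Finset.mem_range]
    split_ifs with hk
    · rfl
    · exact (mem_degreeLT_iff_coeff.1 hr k (not_lt.1 hk)).symm
  rw [hk]
  exact (hconv k).congr' (hev.mono fun n hn => (hqc n hn k).symm)

theorem coeffTendsto_betaInv_bernsteinEigenpoly (s : ℕ) :
    CoeffTendsto (fun n => betaInv n (bernsteinEigenpoly n s)) (limitPoly s) := by
  have hev : ∀ᶠ n : ℕ in atTop, n ≠ 0 ∧ s ≤ n :=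
    (eventually_ne_atTop 0).and (eventually_ge_atTop s)
  refine CoeffTendsto.of_triangular (T := betaLin) (S := LinearMap.id) (m := s + 1)
    (fun d _ => ?_) (fun d _ => ?_) (fun d _ => ?_)
    (hev.mono fun n hn => (betaInv_spec hn.1 hn.2 (bernsteinEigenpoly_mem hn.1 hn.2)).1)
    (limitPoly_mem s) ?_
  · simpa [betaLin] using coeffTendsto_betaMonomial d
  · filter_upwards with n
    rw [betaLin, monomialMap_X_pow]
    exact betaMonomial_mem n d
  · simp
  · exact (coeffTendsto_bernsteinEigenpoly s).congr' (hev.mono fun n hn =>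
      (betaInv_spec hn.1 hn.2 (bernsteinEigenpoly_mem hn.1 hn.2)).2.symm)

theorem tendsto_polyFun_betaInv_bernsteinEigenpoly (s : ℕ) :
    Tendsto (fun n => polyFun (betaInv n (bernsteinEigenpoly n s))) atTop
      (𝓝 (polyFun (limitPoly s))) := by
  refine (coeffTendsto_betaInv_bernsteinEigenpoly s).tendsto_polyFun (m := s + 1) ?_
  filter_upwards [eventually_ne_atTop 0, eventually_ge_atTop s] with n hn hs
  exact (betaInv_spec hn hs (bernsteinEigenpoly_mem hn hs)).1

theorem polyFun_opF {n : ℕ} (hn : n ≠ 0) (f : C(I, ℝ)) :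
    polyFun (opF n f) = ∑ k ∈ Finset.range (n + 1), expansionTerm n k f := by
  have h := (isBernsteinExpansion_dualFunctional hn f).1
  simp only [← smul_eq_C_mul] at h
  rw [opF, h, betaInv_sum_smul hn, polyFun_sum]
  · simp only [polyFun_smul, expansionTerm]
  · intro k hk
    have hk : k ≤ n := by simpa [Nat.lt_succ_iff] using hk
    exact degreeLT_le_degreeLT (Nat.succ_le_succ hk) (bernsteinEigenpoly_mem hn hk)

theorem polyFun_opF_bernsteinEigenpoly {n s : ℕ} (hn : n ≠ 0) (hs : s ≤ n) :
    polyFun (opF n (polyFun (bernsteinEigenpoly n s))) =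
      bernsteinEigenvalue n s • polyFun (betaInv n (bernsteinEigenpoly n s)) := by
  have h := betaInv_sum_smul hn {s} (fun k => bernsteinEigenvalue n k)
    (p := fun k => bernsteinEigenpoly n k) (fun k hk => by
      rw [Finset.mem_singleton.1 hk]
      exact degreeLT_le_degreeLT (Nat.succ_le_succ hs) (bernsteinEigenpoly_mem hn hs))
  rw [Finset.sum_singleton, Finset.sum_singleton] at h
  rw [opF, ← bernsteinLin_apply, bernsteinLin_bernsteinEigenpoly hn hs, h, polyFun_smul]

end

theorem mainTheorem7 :
    -- the inverse, the eigenpolynomials and the dual functionals are well defined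
    (∀ n : ℕ, 1 ≤ n →
      (∀ p ∈ degreeLE ℝ n, ∃! q : ℝ[X], IsBetaPreimage n p q) ∧
      (∀ k ≤ n, ∃! p : ℝ[X], IsBernsteinEigenpoly n k p) ∧
      (∀ f : C(I, ℝ), ∃! c : ℕ → ℝ, IsBernsteinExpansion n f c)) ∧
    -- the starred objects are the limits of the eigenpolynomials and of the dual functionals
    (∀ s : ℕ, Tendsto (fun n : ℕ => polyFun (bernsteinEigenpoly n s)) atTop
      (𝓝 (polyFun (limitPoly s)))) ∧
    (∀ (k : ℕ) (p : ℝ[X]), Tendsto (fun n : ℕ => dualFunctional n k (polyFun p)) atTop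
      (𝓝 (limitFunctional k (polyFun p)))) ∧
    -- the limit relations for the inverse Beta operator and for `F_n`
    (∀ s : ℕ, Tendsto (fun n : ℕ => polyFun (betaInv n (bernsteinEigenpoly n s))) atTop
      (𝓝 (polyFun (limitPoly s)))) ∧
    (∀ s : ℕ, Tendsto (fun n : ℕ => polyFun (opF n (polyFun (bernsteinEigenpoly n s)))) atTop
      (𝓝 (polyFun (limitPoly s)))) ∧
    (∀ s : ℕ, limitFunctional s (polyFun (limitPoly s)) = 1) ∧
    -- the conditional expansion of `lim F_n f`
    (CooperWaldronConjecture → ∀ f S : C(I, ℝ), LimitsInterchange f S →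
      Tendsto (fun N : ℕ => ∑ k ∈ Finset.range N, limitFunctional k f • polyFun (limitPoly k))
        atTop (𝓝 S) ∧
      Tendsto (fun n : ℕ => polyFun (opF n f)) atTop (𝓝 S)) := by
  refine ⟨fun n hn => ?_, fun s => ?_, tendsto_dualFunctional_polyFun,
    tendsto_polyFun_betaInv_bernsteinEigenpoly, fun s => ?_, fun s => ?_, ?_⟩
  · have hn : n ≠ 0 := by omega
    exact ⟨fun p hp => existsUnique_isBetaPreimage hn (mem_degreeLE_iff.1 hp),
      fun k hk => existsUnique_isBernsteinEigenpoly hn hk,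
      fun f => existsUnique_isBernsteinExpansion hn f⟩
  · refine (coeffTendsto_bernsteinEigenpoly s).tendsto_polyFun (m := s + 1) ?_
    filter_upwards [eventually_ne_atTop 0, eventually_ge_atTop s] with n hn hs
    exact bernsteinEigenpoly_mem hn hs
  · have h := (tendsto_bernsteinEigenvalue s).smul (tendsto_polyFun_betaInv_bernsteinEigenpoly s)
    rw [one_smul] at h
    refine h.congr' ?_
    filter_upwards [eventually_ne_atTop 0, eventually_ge_atTop s] with n hn hs
    exact (polyFun_opF_bernsteinEigenpoly hn hs).symm
  · rw [limitFunctional_limitPoly, if_pos rfl]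
  · rintro hCW f S ⟨G, hG, hS, hsum⟩
    have hGk : ∀ k, G k = limitFunctional k f • polyFun (limitPoly k) := fun k => by
      have h := ((tendsto_bernsteinEigenvalue k).mul (hCW k f)).smul
        (tendsto_polyFun_betaInv_bernsteinEigenpoly k)
      rw [one_mul] at h
      exact tendsto_nhds_unique (hG k) h
    refine ⟨by simpa only [hGk] using hS, hsum.congr' ?_⟩
    filter_upwards [eventually_ne_atTop 0] with n hn
    exact (polyFun_opF hn f).symm
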